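/- Let $V=\mathbb R^3$ be the standard representation of $SO(3)$ and let $T=V\oplus V$ carry the orthogonal direct sum inner product and the diagonal action of $SO(3)$; this fixes inclusions $SO(3)\subset SO(6)$ and $\mathfrak{so}(3)\subset\mathfrak{so}(6)\subset\operatorname{End}(T)$. Let $\mathfrak{so}(3)^\perp$ be the orthogonal complement of $\mathfrak{so}(3)$ in $\mathfrak{so}(6)$ for the trace inner product. An $SO(3)$-structure on a smooth six-manifold $M$ is a smooth reduction $P$ to $SO(3)$ of the bundle of linear frames $u\colon T\to T_xM$; it induces a Riemannian metric on $M$. The alternating map $\partial\colon T^*\otimes\mathfrak{so}(6)\to\Lambda^2T^*\otimes T$, $\partial a(x,y)=a(x)y-a(y)x$, is an isomorphism. The intrinsic torsion $\tau\colon P\to T^*\otimes\mathfrak{so}(3)^\perp$ is the $T^*\otimes\mathfrak{so}(3)^\perp$-component of $\partial^{-1}(\Theta)$, where $\Theta$ is the torsion of any connection on $P$ (it does not depend on the connection). The canonical connection is the unique connection on $P$ with torsion $\partial(\tau)$, and $D$ is its exterior covariant derivative; regarding $\tau$ as a tensorial $\mathfrak{so}(3)^\perp$-valued $1$-form on $P$,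 one obtains $D\tau\colon P\to\Lambda^2T^*\otimes\mathfrak{so}(3)^\perp$. Proposition. There are $SO(3)$-equivariant linear maps $$R^{\mathfrak{so}(6)}\colon S^2(T^*\otimes\mathfrak{so}(3)^\perp)\oplus\Lambda^2T^*\otimes\mathfrak{so}(3)^\perp\to\Lambda^2T^*\otimes\mathfrak{so}(6),$$ $$R^{\mathfrak{so}(3)}\colon S^2(T^*\otimes\mathfrak{so}(3)^\perp)\oplus\Lambda^2T^*\otimes\mathfrak{so}(3)^\perp\to\Lambda^2T^*\otimes\mathfrak{so}(3)$$ such that, for every $SO(3)$-structure $P$ on any smooth six-manifold, with intrinsic torsion $\tau$, the function $R^{\mathfrak{so}(6)}(\tau\otimes\tau,D\tau)$ on $P$ is the curvature of the Levi-Civita connection of the induced metric, and the function $R^{\mathfrak{so}(3)}(\tau\otimes\tau,D\tau)$ on $P$ is the curvature of the canonical connection. In particular, if $\tau=0$ on $P$, then the curvatures of the Levi-Civita connection and of the canonical connection both vanish, that is, $P$ is flat. -/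

import Mathlib

open scoped Manifold ContDiff Topology TensorProduct InnerProductSpace

noncomputable section

namespace SO3Geom

/-! ### Linear algebra of the model space -/

/-- The three-dimensional irreducible representation of `SO(3)`. -/
abbrev V : Type := EuclideanSpace ℝ (Fin 3)

/-- The model tangent space `T = V ⊕ V`, with the orthogonal direct sum inner product. -/
def T : Type := WithLp 2 (V × V)

instance : NormedAddCommGroup T := inferInstanceAs (NormedAddCommGroup (WithLp 2 (V × V)))
instance : InnerProductSpace ℝ T := inferInstanceAs (InnerProductSpace ℝ (WithLp 2 (V × V)))
instance : FiniteDimensional ℝ T := inferInstanceAs (FiniteDimensional ℝ (WithLp 2 (V × V)))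

/-- The identification of `T` with `V × V`. -/
def equivT : T ≃L[ℝ] V × V := LinearEquiv.toContinuousLinearEquiv
  (WithLp.linearEquiv 2 ℝ (V × V) : T ≃ₗ[ℝ] V × V)

/-- The first component of a vector of `T = V ⊕ V`. -/
def fstL : T →L[ℝ] V := ContinuousLinearMap.fst ℝ V V ∘L (equivT : T →L[ℝ] V × V)

/-- The second component of a vector of `T = V ⊕ V`. -/
def sndL : T →L[ℝ] V := ContinuousLinearMap.snd ℝ V V ∘L (equivT : T →L[ℝ] V × V)

/-- The inclusion of the first summand of `T = V ⊕ V`. -/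
def inl : V →L[ℝ] T := (equivT.symm : V × V →L[ℝ] T) ∘L ContinuousLinearMap.inl ℝ V V

/-- The inclusion of the second summand of `T = V ⊕ V`. -/
def inr : V →L[ℝ] T := (equivT.symm : V × V →L[ℝ] T) ∘L ContinuousLinearMap.inr ℝ V V

/-- The group `SO(3)`. -/
abbrev SO3 : Type := Matrix.specialOrthogonalGroup (Fin 3) ℝ

/-- The endomorphism `a ⊕ a` of `T = V ⊕ V`. -/
def diag (a : V →L[ℝ] V) : T →L[ℝ] T :=
  (equivT.symm : V × V →L[ℝ] T) ∘L (a.prodMap a) ∘L (equivT : T →L[ℝ] V × V)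

theorem T_ext {x y : T} (h₁ : fstL x = fstL y) (h₂ : sndL x = sndL y) : x = y :=
  equivT.injective (Prod.ext h₁ h₂)

theorem diag_mul (a b : V →L[ℝ] V) : diag (a * b) = diag a * diag b := rfl

theorem diag_one : diag 1 = 1 := rfl

/-- `a ↦ a ⊕ a` as a linear map. -/
def diagₗ : (V →L[ℝ] V) →ₗ[ℝ] (T →L[ℝ] T) where
  toFun := diag
  map_add' _ _ := rfl
  map_smul' _ _ := rfl

/-- The diagonal action of `SO(3)` on `T = V ⊕ V`. -/
def rho : SO3 →* (T →L[ℝ] T) where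
  toFun g := diag (Matrix.toEuclideanCLM (n := Fin 3) (𝕜 := ℝ) (g : Matrix (Fin 3) (Fin 3) ℝ))
  map_one' := by
    simp [diag_one]
  map_mul' g h := by
    rw [← diag_mul, ← map_mul]; rfl

theorem inner_T (x y : T) : ⟪x, y⟫_ℝ = ⟪(fstL x), (fstL y)⟫_ℝ + ⟪(sndL x), (sndL y)⟫_ℝ := rfl

theorem rho_inv_mul (g : SO3) : rho g⁻¹ * rho g = 1 := by rw [← map_mul]; simp
theorem rho_mul_inv (g : SO3) : rho g * rho g⁻¹ = 1 := by rw [← map_mul]; simp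

/-- The linear action of `SO(3)` on `V`, as continuous linear maps. -/
def rhoV : SO3 →* (V →L[ℝ] V) where
  toFun g := Matrix.toEuclideanCLM (n := Fin 3) (𝕜 := ℝ) (g : Matrix (Fin 3) (Fin 3) ℝ)
  map_one' := by simp
  map_mul' g h := by rw [← map_mul]; rfl

theorem rho_eq_diag (g : SO3) : rho g = diag (rhoV g) := rfl

theorem rhoV_inner (g : SO3) (x y : V) : ⟪rhoV g x, y⟫_ℝ = ⟪x, rhoV g⁻¹ y⟫_ℝ := by
  have h : rhoV g⁻¹ = star (rhoV g) := by
    change Matrix.toEuclideanCLM (n := Fin 3) (𝕜 := ℝ) _ = star (Matrix.toEuclideanCLM (n := Fin 3) (𝕜 := ℝ) _)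
    rw [← map_star]; rfl
  rw [h, ContinuousLinearMap.star_eq_adjoint, ContinuousLinearMap.adjoint_inner_right]

theorem rho_inner (g : SO3) (x y : T) : ⟪rho g x, y⟫_ℝ = ⟪x, rho g⁻¹ y⟫_ℝ := by
  rw [inner_T, inner_T]
  exact congrArg₂ (· + ·) (rhoV_inner g _ _) (rhoV_inner g _ _)

/-- Skew-symmetric endomorphisms of a Euclidean space. -/
def skew (E : Type*) [NormedAddCommGroup E] [InnerProductSpace ℝ E] :
    Submodule ℝ (E →L[ℝ] E) where
  carrier := {A | ∀ x y, ⟪A x, y⟫_ℝ = -⟪x, A y⟫_ℝ}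
  zero_mem' := by simp
  add_mem' := by
    intro A B hA hB x y
    simp only [add_apply, inner_add_left, inner_add_right, hA x y, hB x y]
    ring
  smul_mem' := by
    intro c A hA x y
    simp only [smul_apply, inner_smul_left, inner_smul_right, hA x y]
    simp

/-- `so(6)`, the skew-symmetric endomorphisms of `T`. -/
abbrev so6 : Submodule ℝ (T →L[ℝ] T) := skew T

/-- `so(3) ⊂ so(6)`, embedded diagonally. -/
def so3 : Submodule ℝ (T →L[ℝ] T) := (skew V).map diagₗ

/-- `so(3)^⊥`: the orthogonal complement of `so(3)` in `so(6)` for the trace inner product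
`⟨B, A⟩ = tr (Bᵀ A) = - tr (B A)`. -/
def so3perp : Submodule ℝ (T →L[ℝ] T) where
  carrier := {A | A ∈ so6 ∧ ∀ B ∈ so3, LinearMap.trace ℝ T (B * A : T →L[ℝ] T) = 0}
  zero_mem' := ⟨so6.zero_mem, fun B _ => by simp⟩
  add_mem' := by
    rintro A A' ⟨h, h₁⟩ ⟨h', h₂⟩
    refine ⟨so6.add_mem h h', fun B hB => ?_⟩
    rw [mul_add, ContinuousLinearMap.toLinearMap_add, map_add, h₁ B hB, h₂ B hB, add_zero]
  smul_mem' := by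
    rintro c A ⟨h, h₁⟩
    refine ⟨so6.smul_mem c h, fun B hB => ?_⟩
    have e : ((B * c • A : T →L[ℝ] T) : T →ₗ[ℝ] T) = c • ((B * A : T →L[ℝ] T) : T →ₗ[ℝ] T) :=
      LinearMap.ext fun x => map_smul B c (A x)
    rw [e, map_smul, h₁ B hB, smul_zero]

theorem so3_le_so6 : so3 ≤ so6 := by
  rintro _ ⟨a, ha, rfl⟩ x y
  have h₁ := ha (fstL x) (fstL y)
  have h₂ := ha (sndL x) (sndL y)
  change ⟪a (fstL x), (fstL y)⟫_ℝ + ⟪a (sndL x), (sndL y)⟫_ℝ = -(⟪(fstL x), a (fstL y)⟫_ℝ + ⟪(sndL x), a (sndL y)⟫_ℝ)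
  rw [h₁, h₂]; ring

theorem so3perp_le_so6 : so3perp ≤ so6 := fun _ h => h.1

/-! ### Brackets -/

theorem skew_comm {E : Type*} [NormedAddCommGroup E] [InnerProductSpace ℝ E]
    {A B : E →L[ℝ] E} (hA : A ∈ skew E) (hB : B ∈ skew E) : A * B - B * A ∈ skew E := by
  intro x y
  have e₁ := hA (B x) y
  have e₂ := hB x (A y)
  have e₃ := hB (A x) y
  have e₄ := hA x (B y)
  simp only [sub_apply, mul_apply_eq_comp, inner_sub_left, inner_sub_right]
  linarith

theorem comm_so6 {A B : T →L[ℝ] T} (hA : A ∈ so6) (hB : B ∈ so6) : A * B - B * A ∈ so6 :=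
  skew_comm hA hB

theorem comm_so3 {A B : T →L[ℝ] T} (hA : A ∈ so3) (hB : B ∈ so3) : A * B - B * A ∈ so3 := by
  obtain ⟨a, ha, rfl⟩ := hA
  obtain ⟨b, hb, rfl⟩ := hB
  exact ⟨a * b - b * a, skew_comm ha hb, rfl⟩

theorem trace_mul_comm (A B : T →L[ℝ] T) :
    LinearMap.trace ℝ T (A * B : T →L[ℝ] T) = LinearMap.trace ℝ T (B * A : T →L[ℝ] T) :=
  LinearMap.trace_mul_comm ℝ (A : T →ₗ[ℝ] T) (B : T →ₗ[ℝ] T)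

theorem comm_so3perp {A B : T →L[ℝ] T} (hA : A ∈ so3) (hB : B ∈ so3perp) :
    A * B - B * A ∈ so3perp := by
  refine ⟨comm_so6 (so3_le_so6 hA) hB.1, fun C hC => ?_⟩
  have h := hB.2 _ (comm_so3 hC hA)
  have e : LinearMap.trace ℝ T (C * (B * A) : T →L[ℝ] T)
      = LinearMap.trace ℝ T (A * C * B : T →L[ℝ] T) := by
    rw [← mul_assoc, trace_mul_comm, ← mul_assoc]
  rw [sub_mul, ContinuousLinearMap.toLinearMap_sub, map_sub] at h
  rw [mul_sub, ContinuousLinearMap.toLinearMap_sub, map_sub, e, ← mul_assoc]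
  exact h

/-! ### Alternating maps: wedge products and the alternating map `∂` -/

section Alternating

variable {E F : Type*} [NormedAddCommGroup E] [NormedSpace ℝ E]
  [NormedAddCommGroup F] [NormedSpace ℝ F]

/-- The alternation `(x, y) ↦ B(x, y) - B(y, x)` of a bilinear map. -/
def alt2 (B : E →L[ℝ] E →L[ℝ] F) : E [⋀^Fin 2]→L[ℝ] F where
  toFun v := B (v 0) (v 1) - B (v 1) (v 0)
  map_update_add' := by
    intro _ v i x y
    fin_cases i <;> simp [Function.update] <;> abel
  map_update_smul' := by
    intro _ v i c x
    fin_cases i <;> simp [Function.update, smul_sub]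
  map_eq_zero_of_eq' := by
    intro v i j h hij
    fin_cases i <;> fin_cases j <;> simp_all
  cont := by fun_prop

theorem alt2_apply (B : E →L[ℝ] E →L[ℝ] F) (v : Fin 2 → E) :
    alt2 B v = B (v 0) (v 1) - B (v 1) (v 0) := rfl

end Alternating

section Delta

variable {E : Type*} [NormedAddCommGroup E] [InnerProductSpace ℝ E]

/-- The alternating map `∂ : E* ⊗ so(E) → Λ²E* ⊗ E`, `∂a (x, y) = a(x) y - a(y) x`. -/
def delta : (E →L[ℝ] skew E) →ₗ[ℝ] (E [⋀^Fin 2]→L[ℝ] E) where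
  toFun a := alt2 ((skew E).subtypeL ∘L a)
  map_add' a b := by
    ext v : 1
    simp [alt2_apply]; abel
  map_smul' c a := by
    ext v : 1
    simp [alt2_apply, smul_sub]

theorem delta_apply (a : E →L[ℝ] skew E) (v : Fin 2 → E) :
    delta a v = (a (v 0) : E →L[ℝ] E) (v 1) - (a (v 1) : E →L[ℝ] E) (v 0) := rfl

theorem delta_injective : Function.Injective (delta (E := E)) := by
  refine (injective_iff_map_eq_zero delta).2 fun a ha => ?_
  have sym : ∀ x y, (a x : E →L[ℝ] E) y = (a y : E →L[ℝ] E) x := fun x y => by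
    have := congrArg (fun f => f ![x, y]) ha
    simpa [delta_apply, sub_eq_zero] using this
  have sk : ∀ x y z, ⟪(a x : E →L[ℝ] E) y, z⟫_ℝ = -⟪(a x : E →L[ℝ] E) z, y⟫_ℝ := fun x y z => by
    rw [(a x).2 y z, real_inner_comm]
  ext x : 2
  ext1 y
  refine ext_inner_right ℝ fun z => ?_
  have h₁ := sk x y z
  have h₂ := sk y x z
  have h₃ := sk z x y
  rw [sym y x] at h₂
  rw [sym z x, sym z y] at h₃
  simp only [zero_apply, inner_zero_left, ZeroMemClass.coe_zero]
  linarith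

/-- The trilinear form `½ (⟨A(x, y), z⟩ - ⟨A(y, z), x⟩ + ⟨A(z, x), y⟩)`, as a function of `z`. -/
def koszul (A : E [⋀^Fin 2]→L[ℝ] E) (x y z : E) : ℝ :=
  (1 / 2 : ℝ) * (⟪A ![x, y], z⟫_ℝ - ⟪A ![y, z], x⟫_ℝ + ⟪A ![z, x], y⟫_ℝ)

theorem alt_swap (A : E [⋀^Fin 2]→L[ℝ] E) (x y : E) : A ![y, x] = -A ![x, y] := by
  have h := A.toAlternatingMap.map_swap ![x, y] (i := 0) (j := 1) (by decide)
  have e : (![x, y] ∘ (Equiv.swap (0 : Fin 2) 1)) = ![y, x] := by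
    funext i; fin_cases i <;> simp
  rw [e] at h
  exact h

/-- `A(x, y)` as a bilinear map. -/
def bil (A : E [⋀^Fin 2]→L[ℝ] E) : E →ₗ[ℝ] E →ₗ[ℝ] E :=
  LinearMap.mk₂ ℝ (fun x y => A ![x, y])
    (fun x x' y => A.vecCons_add ![y] x x')
    (fun c x y => A.vecCons_smul ![y] c x)
    (fun x y y' => by
      rw [← neg_inj, ← alt_swap, neg_add, ← alt_swap, ← alt_swap]; exact A.vecCons_add ![x] y y')
    (fun c x y => by
      rw [← neg_inj, ← alt_swap, ← smul_neg, ← alt_swap]; exact A.vecCons_smul ![x] c y)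

theorem delta_surjective [FiniteDimensional ℝ E] : Function.Surjective (delta (E := E)) := by
  intro A
  have add₁ : ∀ x x' y, A ![x + x', y] = A ![x, y] + A ![x', y] :=
    fun x x' y => (bil A).map_add₂ x x' y
  have add₂ : ∀ x y y', A ![x, y + y'] = A ![x, y] + A ![x, y'] :=
    fun x y y' => (bil A x).map_add y y'
  have smul₁ : ∀ (c : ℝ) x y, A ![c • x, y] = c • A ![x, y] :=
    fun c x y => (bil A).map_smul₂ c x y
  have smul₂ : ∀ (c : ℝ) x y, A ![x, c • y] = c • A ![x, y] :=
    fun c x y => (bil A x).map_smul c y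
  have : CompleteSpace E := FiniteDimensional.complete ℝ E
  let K : E → E → (E →L[ℝ] ℝ) := fun x y => LinearMap.toContinuousLinearMap
    { toFun := koszul A x y
      map_add' := fun z z' => by
        simp only [koszul, add₁, add₂, inner_add_left, inner_add_right]; ring
      map_smul' := fun c z => by
        simp only [koszul, smul₁, smul₂, inner_smul_left, inner_smul_right, RingHom.id_apply,
          smul_eq_mul, conj_trivial]; ring }
  let Γ : E → E → E := fun x y => (InnerProductSpace.toDual ℝ E).symm (K x y)
  have hΓ : ∀ x y z, ⟪Γ x y, z⟫_ℝ = koszul A x y z := fun x y z => by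
    simp only [Γ, InnerProductSpace.toDual_symm_apply]; rfl
  let B : E → (E →L[ℝ] E) := fun x => LinearMap.toContinuousLinearMap
    { toFun := Γ x
      map_add' := fun y y' => ext_inner_right ℝ fun z => by
        simp only [inner_add_left, hΓ, koszul, add₁, add₂, inner_add_right]; ring
      map_smul' := fun c y => ext_inner_right ℝ fun z => by
        simp only [hΓ, koszul, smul₁, smul₂, inner_smul_left, inner_smul_right, RingHom.id_apply,
          conj_trivial]; ring }
  have hB : ∀ x y z, ⟪B x y, z⟫_ℝ = koszul A x y z := hΓ
  have hskew : ∀ x, B x ∈ skew E := fun x y z => by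
    rw [real_inner_comm (B x z) y, hB, hB]
    simp only [koszul]
    rw [alt_swap A z x, alt_swap A y x, alt_swap A y z]
    simp only [inner_neg_left]; ring
  refine ⟨LinearMap.toContinuousLinearMap
    { toFun := fun x => (⟨B x, hskew x⟩ : skew E)
      map_add' := fun x x' => Subtype.ext <| ContinuousLinearMap.ext fun y =>
        ext_inner_right ℝ fun z => by
          change ⟪B (x + x') y, z⟫_ℝ = ⟪B x y + B x' y, z⟫_ℝ
          simp only [inner_add_left, hB, koszul, add₁, add₂, inner_add_right]; ring
      map_smul' := fun c x => Subtype.ext <| ContinuousLinearMap.ext fun y =>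
        ext_inner_right ℝ fun z => by
          change ⟪B (c • x) y, z⟫_ℝ = ⟪c • B x y, z⟫_ℝ
          simp only [hB, koszul, smul₁, smul₂, inner_smul_left, inner_smul_right,
            conj_trivial]; ring }, ?_⟩
  ext v : 1
  refine ext_inner_right ℝ fun z => ?_
  have hv : v = ![v 0, v 1] := by funext i; fin_cases i <;> rfl
  rw [delta_apply]
  change ⟪B (v 0) (v 1) - B (v 1) (v 0), z⟫_ℝ = _
  rw [hv]
  simp only [inner_sub_left, hB, koszul, Matrix.cons_val_zero, Matrix.cons_val_one]
  rw [alt_swap A (v 0) (v 1), alt_swap A (v 0) z, alt_swap A (v 1) z]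
  simp only [inner_neg_left]; ring

/-- The isomorphism `∂ : E* ⊗ so(E) ≅ Λ²E* ⊗ E`. -/
def deltaEquiv [FiniteDimensional ℝ E] : (E →L[ℝ] skew E) ≃ₗ[ℝ] (E [⋀^Fin 2]→L[ℝ] E) :=
  LinearEquiv.ofBijective delta ⟨delta_injective, delta_surjective⟩

theorem delta_symm [FiniteDimensional ℝ E] (A : E [⋀^Fin 2]→L[ℝ] E) :
    delta (deltaEquiv.symm A) = A := deltaEquiv.apply_symm_apply A

theorem delta_neg_symm [FiniteDimensional ℝ E] (A : E [⋀^Fin 2]→L[ℝ] E) :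
    delta (-deltaEquiv.symm A) = -A := by
  have h := delta.map_neg (deltaEquiv.symm A)
  rw [delta_symm] at h
  exact h

end Delta

/-- For `a ∈ T* ⊗ 𝔞`, `b ∈ T* ⊗ 𝔟` with `[𝔞, 𝔟] ⊂ 𝔠`, the element
`[a ∧ b](x, y) = [a x, b y] - [a y, b x]` of `Λ²T* ⊗ 𝔠`. -/
def bracketWedge {E : Type*} [NormedAddCommGroup E] [NormedSpace ℝ E] [FiniteDimensional ℝ E]
    {𝔞 𝔟 𝔠 : Submodule ℝ (E →L[ℝ] E)}
    (h : ∀ {A B : E →L[ℝ] E}, A ∈ 𝔞 → B ∈ 𝔟 → A * B - B * A ∈ 𝔠)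
    (a : E →L[ℝ] 𝔞) (b : E →L[ℝ] 𝔟) : E [⋀^Fin 2]→L[ℝ] 𝔠 :=
  alt2 (LinearMap.toContinuousBilinearMap
    (LinearMap.mk₂ ℝ
      (fun x y => (⟨(a x : E →L[ℝ] E) * (b y : E →L[ℝ] E) - (b y : E →L[ℝ] E) * (a x : E →L[ℝ] E),
        h (a x).2 (b y).2⟩ : 𝔠))
      (fun x x' y => Subtype.ext (by simp [add_mul, mul_add]; abel))
      (fun c x y => Subtype.ext (by simp [smul_sub]))
      (fun x y y' => Subtype.ext (by simp [add_mul, mul_add]; abel))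
      (fun c x y => Subtype.ext (by simp [smul_sub]))))

/-! ### The orthogonal projections of `so(6) = so(3) ⊕ so(3)^⊥` -/

/-- Half the sum of the two diagonal blocks of an endomorphism of `V ⊕ V`. -/
def meanBlock : (T →L[ℝ] T) →ₗ[ℝ] (V →L[ℝ] V) where
  toFun A := (1 / 2 : ℝ) • (fstL ∘L A ∘L inl + sndL ∘L A ∘L inr)
  map_add' A B := by
    ext x : 1
    simp only [smul_apply, add_apply, ContinuousLinearMap.comp_apply, map_add, smul_add]
    abel
  map_smul' c A := by
    ext x : 1
    simp only [smul_apply, add_apply, ContinuousLinearMap.comp_apply, map_smul, smul_add,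
      RingHom.id_apply, smul_comm c]

theorem meanBlock_diag (a : V →L[ℝ] V) : meanBlock (diag a) = a := by
  ext x : 1
  change (1 / 2 : ℝ) • (a x + a x) = a x
  rw [← two_smul ℝ, smul_smul]; norm_num

theorem meanBlock_skew {A : T →L[ℝ] T} (hA : A ∈ so6) : meanBlock A ∈ skew V := by
  intro x y
  have h₁ := hA (inl x) (inl y)
  have h₂ := hA (inr x) (inr y)
  rw [inner_T, inner_T] at h₁ h₂
  have e₁ : fstL (inl x) = x := rfl
  have e₂ : sndL (inl x) = 0 := rfl
  have e₃ : sndL (inr x) = x := rfl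
  have e₄ : fstL (inr x) = 0 := rfl
  have f₁ : fstL (inl y) = y := rfl
  have f₂ : sndL (inl y) = 0 := rfl
  have f₃ : sndL (inr y) = y := rfl
  have f₄ : fstL (inr y) = 0 := rfl
  rw [e₁, e₂, f₁, f₂, inner_zero_right, inner_zero_left] at h₁
  rw [e₃, e₄, f₃, f₄, inner_zero_right, inner_zero_left] at h₂
  change ⟪(1 / 2 : ℝ) • (fstL (A (inl x)) + sndL (A (inr x))), y⟫_ℝ
    = -⟪x, (1 / 2 : ℝ) • (fstL (A (inl y)) + sndL (A (inr y)))⟫_ℝ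
  rw [real_inner_smul_left, real_inner_smul_right, inner_add_left, inner_add_right]
  linarith

theorem trace_diag_mul (b : V →L[ℝ] V) (A : T →L[ℝ] T) :
    LinearMap.trace ℝ T (diag b * A : T →L[ℝ] T)
      = 2 * LinearMap.trace ℝ V (b * meanBlock A : V →L[ℝ] V) := by
  have dec : ((diag b * A : T →L[ℝ] T) : T →ₗ[ℝ] T)
      = (inl : V →ₗ[ℝ] T) ∘ₗ ((b ∘L fstL ∘L A : T →L[ℝ] V) : T →ₗ[ℝ] V)
        + (inr : V →ₗ[ℝ] T) ∘ₗ ((b ∘L sndL ∘L A : T →L[ℝ] V) : T →ₗ[ℝ] V) := by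
    refine LinearMap.ext fun x => T_ext ?_ ?_
    · exact (add_zero _).symm
    · exact (zero_add _).symm
  have mean : ((b * meanBlock A : V →L[ℝ] V) : V →ₗ[ℝ] V)
      = (1 / 2 : ℝ) • (((b ∘L fstL ∘L A : T →L[ℝ] V) : T →ₗ[ℝ] V) ∘ₗ (inl : V →ₗ[ℝ] T)
        + ((b ∘L sndL ∘L A : T →L[ℝ] V) : T →ₗ[ℝ] V) ∘ₗ (inr : V →ₗ[ℝ] T)) := by
    refine LinearMap.ext fun x => ?_
    change b ((1 / 2 : ℝ) • (fstL (A (inl x)) + sndL (A (inr x))))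
      = (1 / 2 : ℝ) • (b (fstL (A (inl x))) + b (sndL (A (inr x))))
    rw [map_smul, map_add]
  rw [dec, mean, map_add, map_smul, map_add, LinearMap.trace_comp_comm',
    LinearMap.trace_comp_comm' (inr : V →ₗ[ℝ] T), smul_eq_mul]
  ring

theorem diag_meanBlock_mem {A : T →L[ℝ] T} (hA : A ∈ so6) : diag (meanBlock A) ∈ so3 :=
  ⟨meanBlock A, meanBlock_skew hA, rfl⟩

theorem sub_diag_meanBlock_mem {A : T →L[ℝ] T} (hA : A ∈ so6) :
    A - diag (meanBlock A) ∈ so3perp := by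
  refine ⟨so6.sub_mem hA (so3_le_so6 (diag_meanBlock_mem hA)), ?_⟩
  rintro _ ⟨b, -, rfl⟩
  change LinearMap.trace ℝ T (diag b * (A - diag (meanBlock A)) : T →L[ℝ] T) = 0
  rw [trace_diag_mul, map_sub, meanBlock_diag, sub_self, mul_zero]
  simp

/-- The orthogonal projection `so(6) → so(3)`. -/
def projSo3 : so6 →L[ℝ] so3 := LinearMap.toContinuousLinearMap
  { toFun := fun A => ⟨diag (meanBlock A), diag_meanBlock_mem A.2⟩
    map_add' := fun A B => Subtype.ext <| by
      change diagₗ (meanBlock (A + B : T →L[ℝ] T)) = diagₗ (meanBlock A) + diagₗ (meanBlock B)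
      rw [map_add, map_add]
    map_smul' := fun c A => Subtype.ext <| by
      change diagₗ (meanBlock (c • (A : T →L[ℝ] T))) = c • diagₗ (meanBlock A)
      rw [map_smul, map_smul] }

/-- The orthogonal projection `so(6) → so(3)^⊥`. -/
def projPerp : so6 →L[ℝ] so3perp := LinearMap.toContinuousLinearMap
  { toFun := fun A => ⟨A - projSo3 A, sub_diag_meanBlock_mem A.2⟩
    map_add' := fun A B => Subtype.ext <| by
      change (A + B : T →L[ℝ] T) - projSo3 (A + B)
        = ((A : T →L[ℝ] T) - projSo3 A) + ((B : T →L[ℝ] T) - projSo3 B)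
      rw [map_add, Submodule.coe_add]; abel
    map_smul' := fun c A => Subtype.ext <| by
      change (c • (A : T →L[ℝ] T)) - projSo3 (c • A) = c • ((A : T →L[ℝ] T) - projSo3 A)
      rw [map_smul, Submodule.coe_smul, smul_sub] }

theorem projSo3_add_projPerp (A : so6) :
    (projSo3 A : T →L[ℝ] T) + (projPerp A : T →L[ℝ] T) = A :=
  add_sub_cancel (projSo3 A : T →L[ℝ] T) (A : T →L[ℝ] T)

theorem projPerp_of_mem (A : so6) (hA : (A : T →L[ℝ] T) ∈ so3) : projPerp A = 0 := by
  obtain ⟨a, -, ha⟩ := hA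
  refine Subtype.ext ?_
  change (A : T →L[ℝ] T) - diag (meanBlock A) = 0
  rw [← ha]
  change diag a - diag (meanBlock (diag a)) = 0
  rw [meanBlock_diag, sub_self]

/-- The inclusions `so(3) ⊂ so(6)` and `so(3)^⊥ ⊂ so(6)`. -/
def inclSo3 : so3 →L[ℝ] so6 := so3.subtypeL.codRestrict so6 fun A => so3_le_so6 A.2
def inclPerp : so3perp →L[ℝ] so6 :=
  so3perp.subtypeL.codRestrict so6 fun A => A.2.1

/-! ### The `SO(3)`-modules -/

theorem Ad_so6 (g : SO3) {A : T →L[ℝ] T} (hA : A ∈ so6) : rho g * A * rho g⁻¹ ∈ so6 := by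
  intro x y
  have h := hA (rho g⁻¹ x) (rho g⁻¹ y)
  have e := rho_inner g (A (rho g⁻¹ x)) y
  have e' := rho_inner g (A (rho g⁻¹ y)) x
  change ⟪rho g (A (rho g⁻¹ x)), y⟫_ℝ = -⟪x, rho g (A (rho g⁻¹ y))⟫_ℝ
  rw [e, h, real_inner_comm (rho g (A (rho g⁻¹ y))) x, e', real_inner_comm]

theorem Ad_so3 (g : SO3) {A : T →L[ℝ] T} (hA : A ∈ so3) : rho g * A * rho g⁻¹ ∈ so3 := by
  obtain ⟨a, ha, rfl⟩ := hA
  refine ⟨rhoV g * a * rhoV g⁻¹, fun x y => ?_, rfl⟩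
  have h := ha (rhoV g⁻¹ x) (rhoV g⁻¹ y)
  have e := rhoV_inner g (a (rhoV g⁻¹ x)) y
  have e' := rhoV_inner g (a (rhoV g⁻¹ y)) x
  change ⟪rhoV g (a (rhoV g⁻¹ x)), y⟫_ℝ = -⟪x, rhoV g (a (rhoV g⁻¹ y))⟫_ℝ
  rw [e, h, real_inner_comm (rhoV g (a (rhoV g⁻¹ y))) x, e', real_inner_comm]

theorem Ad_so3perp (g : SO3) {A : T →L[ℝ] T} (hA : A ∈ so3perp) :
    rho g * A * rho g⁻¹ ∈ so3perp := by
  refine ⟨Ad_so6 g hA.1, fun B hB => ?_⟩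
  have h := hA.2 _ (Ad_so3 g⁻¹ hB)
  rw [inv_inv] at h
  rw [← mul_assoc, trace_mul_comm, ← mul_assoc, ← mul_assoc]
  exact h

/-- The adjoint action `A ↦ ρ(g) A ρ(g)⁻¹` on an invariant subspace of `End T`. -/
def adRep (𝔞 : Submodule ℝ (T →L[ℝ] T))
    (h : ∀ (g : SO3) {A : T →L[ℝ] T}, A ∈ 𝔞 → rho g * A * rho g⁻¹ ∈ 𝔞) :
    Representation ℝ SO3 𝔞 where
  toFun g :=
    { toFun := fun A => ⟨rho g * A * rho g⁻¹, h g A.2⟩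
      map_add' := fun A B => Subtype.ext <| by
        simp only [Submodule.coe_add, mul_add, add_mul]
      map_smul' := fun c A => Subtype.ext <| ContinuousLinearMap.ext fun x =>
        map_smul (rho g) c ((A : T →L[ℝ] T) (rho g⁻¹ x)) }
  map_one' := LinearMap.ext fun A => Subtype.ext <| by
    simp
  map_mul' g g' := LinearMap.ext fun A => Subtype.ext <| by
    change rho (g * g') * (A : T →L[ℝ] T) * rho (g * g')⁻¹
      = rho g * (rho g' * (A : T →L[ℝ] T) * rho g'⁻¹) * rho g⁻¹
    rw [mul_inv_rev, map_mul, map_mul]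
    simp only [mul_assoc]

section Rep

variable {F : Type*} [AddCommGroup F] [Module ℝ F] [TopologicalSpace F] [IsTopologicalAddGroup F]
  [ContinuousSMul ℝ F] [T2Space F] [FiniteDimensional ℝ F]

/-- The representation on `T* ⊗ F`, `(g · a)(x) = g · a(g⁻¹ x)`. -/
def homRep (σ : Representation ℝ SO3 F) : Representation ℝ SO3 (T →L[ℝ] F) where
  toFun g :=
    { toFun := fun a => LinearMap.toContinuousLinearMap (σ g) ∘L a ∘L rho g⁻¹
      map_add' := fun a b => ContinuousLinearMap.ext fun x =>
        map_add (σ g) (a (rho g⁻¹ x)) (b (rho g⁻¹ x))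
      map_smul' := fun c a => ContinuousLinearMap.ext fun x =>
        map_smul (σ g) c (a (rho g⁻¹ x)) }
  map_one' := LinearMap.ext fun a => ContinuousLinearMap.ext fun x => by
    change σ 1 (a (rho 1⁻¹ x)) = a x
    rw [inv_one, map_one, map_one]; rfl
  map_mul' g g' := LinearMap.ext fun a => ContinuousLinearMap.ext fun x => by
    change σ (g * g') (a (rho (g * g')⁻¹ x)) = σ g (σ g' (a (rho g'⁻¹ (rho g⁻¹ x))))
    rw [mul_inv_rev, map_mul, map_mul]; rfl

/-- The representation on `Λ²T* ⊗ F`, `(g · η)(x, y) = g · η(g⁻¹ x, g⁻¹ y)`. -/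
def altRep (σ : Representation ℝ SO3 F) : Representation ℝ SO3 (T [⋀^Fin 2]→L[ℝ] F) where
  toFun g :=
    { toFun := fun η => (LinearMap.toContinuousLinearMap (σ g)).compContinuousAlternatingMap
        (η.compContinuousLinearMap (rho g⁻¹))
      map_add' := fun η η' => ContinuousAlternatingMap.ext fun v =>
        map_add (σ g) (η (fun i => rho g⁻¹ (v i))) (η' (fun i => rho g⁻¹ (v i)))
      map_smul' := fun c η => ContinuousAlternatingMap.ext fun v =>
        map_smul (σ g) c (η (fun i => rho g⁻¹ (v i))) }
  map_one' := LinearMap.ext fun η => ContinuousAlternatingMap.ext fun v => by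
    change σ 1 (η (fun i => rho 1⁻¹ (v i))) = η v
    rw [inv_one, map_one, map_one]; rfl
  map_mul' g g' := LinearMap.ext fun η => ContinuousAlternatingMap.ext fun v => by
    change σ (g * g') (η (fun i => rho (g * g')⁻¹ (v i)))
      = σ g (σ g' (η (fun i => rho g'⁻¹ (rho g⁻¹ (v i)))))
    rw [mul_inv_rev, map_mul, map_mul]; rfl

end Rep

/-- The symmetric square `S²W ⊂ W ⊗ W`: the tensors fixed by the swap `x ⊗ y ↦ y ⊗ x`. -/
def SymSq (W : Type*) [AddCommGroup W] [Module ℝ W] : Submodule ℝ (W ⊗[ℝ] W) :=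
  LinearMap.eqLocus (TensorProduct.comm ℝ W W : W ⊗[ℝ] W →ₗ[ℝ] W ⊗[ℝ] W) LinearMap.id

/-- The element `w ⊗ w` of `S²W`. -/
def tsq {W : Type*} [AddCommGroup W] [Module ℝ W] (w : W) : SymSq W := ⟨w ⊗ₜ[ℝ] w, rfl⟩

/-- The representation on `S²W` induced by a representation on `W`. -/
def symSqRep {W : Type*} [AddCommGroup W] [Module ℝ W] (σ : Representation ℝ SO3 W) :
    Representation ℝ SO3 (SymSq W) :=
  (σ.tprod σ).subrepresentation (SymSq W) fun g t ht => by
    have e : (TensorProduct.comm ℝ W W : W ⊗[ℝ] W →ₗ[ℝ] W ⊗[ℝ] W) ∘ₗ (σ.tprod σ) g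
        = (σ.tprod σ) g ∘ₗ (TensorProduct.comm ℝ W W : W ⊗[ℝ] W →ₗ[ℝ] W ⊗[ℝ] W) := by
      refine TensorProduct.ext' fun x y => rfl
    have h : (TensorProduct.comm ℝ W W : W ⊗[ℝ] W →ₗ[ℝ] W ⊗[ℝ] W) t = t := ht
    change (TensorProduct.comm ℝ W W : W ⊗[ℝ] W →ₗ[ℝ] W ⊗[ℝ] W) ((σ.tprod σ) g t)
      = (σ.tprod σ) g t
    have := LinearMap.congr_fun e t
    rw [LinearMap.comp_apply, LinearMap.comp_apply, h] at this
    exact this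

/-- The space `T* ⊗ so(3)^⊥` of intrinsic torsion. -/
abbrev TorsionSpace : Type := T →L[ℝ] so3perp

/-- The space `Λ²T* ⊗ 𝔞`. -/
abbrev TwoForms (𝔞 : Submodule ℝ (T →L[ℝ] T)) : Type := T [⋀^Fin 2]→L[ℝ] 𝔞

/-- The representation of `SO(3)` on `T* ⊗ so(3)^⊥`. -/
def torsionRep : Representation ℝ SO3 TorsionSpace :=
  homRep (F := so3perp) (adRep so3perp Ad_so3perp)

/-- The representation of `SO(3)` on `Λ²T* ⊗ so(3)^⊥`. -/
def perpFormRep : Representation ℝ SO3 (TwoForms so3perp) :=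
  altRep (F := so3perp) (adRep so3perp Ad_so3perp)

/-- The representation of `SO(3)` on `S²(T* ⊗ so(3)^⊥) ⊕ Λ²T* ⊗ so(3)^⊥`. -/
def sourceRep : Representation ℝ SO3 (SymSq TorsionSpace × TwoForms so3perp) :=
  (symSqRep (W := TorsionSpace) torsionRep).prod perpFormRep

/-- The representation of `SO(3)` on `Λ²T* ⊗ so(6)`. -/
def curvRep6 : Representation ℝ SO3 (TwoForms so6) := altRep (F := so6) (adRep so6 Ad_so6)

/-- The representation of `SO(3)` on `Λ²T* ⊗ so(3)`. -/
def curvRep3 : Representation ℝ SO3 (TwoForms so3) := altRep (F := so3) (adRep so3 Ad_so3)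

/-! ### `SO(3)`-structures on six-manifolds -/

/-- The model space of six-manifolds. -/
abbrev E6 : Type := EuclideanSpace ℝ (Fin 6)

/-- `rho g` as an invertible map. -/
def rhoEquiv (g : SO3) : T ≃L[ℝ] T :=
  ContinuousLinearEquiv.equivOfInverse (rho g) (rho g⁻¹)
    (fun t => congrArg (fun A : T →L[ℝ] T => A t) (rho_inv_mul g))
    (fun t => congrArg (fun A : T →L[ℝ] T => A t) (rho_mul_inv g))

section Manifold

variable {M : Type*} [TopologicalSpace M] [ChartedSpace E6 M]

section ExteriorDerivative

variable {F : Type*} [NormedAddCommGroup F] [NormedSpace ℝ F]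

/-- The pullback of an `F`-valued 1-form on `M` by the inverse of the preferred chart at `m`. -/
def chartForm (α : ∀ x : M, TangentSpace (𝓡 6) x →L[ℝ] F) (m : M) : E6 → E6 [⋀^Fin 1]→L[ℝ] F :=
  fun z => ContinuousAlternatingMap.ofSubsingleton ℝ E6 F (0 : Fin 1)
    ((α ((extChartAt (𝓡 6) m).symm z)) ∘L
      (mfderiv 𝓘(ℝ, E6) (𝓡 6) (extChartAt (𝓡 6) m).symm z :
        E6 →L[ℝ] TangentSpace (𝓡 6) ((extChartAt (𝓡 6) m).symm z)))

/-- The exterior derivative at `m` of an `F`-valued 1-form on `M`: the exterior derivative of its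
expression in the preferred chart at `m`, pulled back by that chart. The normalization is
`dα(X, Y) = X(α(Y)) - Y(α(X)) - α([X, Y])`. -/
def extD (α : ∀ x : M, TangentSpace (𝓡 6) x →L[ℝ] F) (m : M) :
    TangentSpace (𝓡 6) m [⋀^Fin 2]→L[ℝ] F :=
  (extDeriv (chartForm α m) (extChartAt (𝓡 6) m m)).compContinuousLinearMap
    (mfderiv (𝓡 6) 𝓘(ℝ, E6) (extChartAt (𝓡 6) m) m : TangentSpace (𝓡 6) m →L[ℝ] E6)

/-- A (not necessarily continuous) field of frames `s x : T ≅ T_x M`. -/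
abbrev FrameField (M : Type*) [TopologicalSpace M] [ChartedSpace E6 M] : Type _ :=
  ∀ x : M, T ≃L[ℝ] TangentSpace (𝓡 6) x

/-- The 1-form on `M` whose components in the frame `s` are `a : M → T* ⊗ F`. For `a = id_T` this
is the coframe dual to `s`, i.e. the pullback by `s` of the tautological form `θ`. -/
def formOf (s : FrameField M) (a : M → T →L[ℝ] F) (x : M) : TangentSpace (𝓡 6) x →L[ℝ] F :=
  a x ∘L ((s x).symm : TangentSpace (𝓡 6) x →L[ℝ] T)

/-- The components in the frame `s` of the exterior derivative of the 1-form with components `a`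
in the frame `s`, as an element of `Λ²T* ⊗ F`. -/
def dFrame (s : FrameField M) (a : M → T →L[ℝ] F) (x : M) : T [⋀^Fin 2]→L[ℝ] F :=
  (extD (formOf s a) x).compContinuousLinearMap (s x : T →L[ℝ] TangentSpace (𝓡 6) x)

end ExteriorDerivative

/-- `s` is a smooth field of frames on the open set `U`. -/
def IsSmoothFrameOn [IsManifold (𝓡 6) ∞ M] (U : Set M) (s : FrameField M) : Prop :=
  IsOpen U ∧ ∀ t : T, ContMDiffOn (𝓡 6) (𝓡 6).tangent ∞
    (fun x => (⟨x, s x t⟩ : TangentBundle (𝓡 6) M)) U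

/-- An `SO(3)`-structure on a six-manifold `M`: a smooth reduction `P` to
`SO(3) ⊂ SO(6) ⊂ GL(T)` of the bundle of frames `u : T ≅ T_x M`, on which `g ∈ SO(3)` acts from the
right by `u ↦ u ∘ ρ(g)`. -/
structure SO3Structure (M : Type*) [TopologicalSpace M] [ChartedSpace E6 M]
    [IsManifold (𝓡 6) ∞ M] where
  /-- The fibre of `P` over `x`. -/
  frames (x : M) : Set (T ≃L[ℝ] TangentSpace (𝓡 6) x)
  /-- The fibres are orbits of `SO(3)`. -/
  orbit (x : M) (u : T ≃L[ℝ] TangentSpace (𝓡 6) x) (hu : u ∈ frames x)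
    (u' : T ≃L[ℝ] TangentSpace (𝓡 6) x) : u' ∈ frames x ↔ ∃ g : SO3, u' = (rhoEquiv g).trans u
  /-- `P` has smooth local sections. -/
  exists_section (x : M) : ∃ (U : Set M) (s : FrameField M),
    x ∈ U ∧ IsSmoothFrameOn U s ∧ ∀ y ∈ U, s y ∈ frames y

/-- `s` is a smooth local section of `P` over the open set `U`. -/
def SO3Structure.IsLocalSection [IsManifold (𝓡 6) ∞ M] (P : SO3Structure M) (U : Set M)
    (s : FrameField M) : Prop :=
  IsSmoothFrameOn U s ∧ ∀ y ∈ U, s y ∈ P.frames y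

/-- Every point `u` of `P` lies on a smooth local section. -/
theorem SO3Structure.exists_section_through [IsManifold (𝓡 6) ∞ M] (P : SO3Structure M)
    (x : M)
    (u : T ≃L[ℝ] TangentSpace (𝓡 6) x) (hu : u ∈ P.frames x) :
    ∃ U s, x ∈ U ∧ P.IsLocalSection U s ∧ s x = u := by
  obtain ⟨U, s, hx, hs, hP⟩ := P.exists_section x
  obtain ⟨g, hg⟩ := (P.orbit x (s x) (hP x hx) u).1 hu
  exact ⟨U, fun y => (rhoEquiv g).trans (s y), hx,
    ⟨⟨hs.1, fun t => hs.2 (rho g t)⟩, fun y hy => (P.orbit y (s y) (hP y hy) _).2 ⟨g, rfl⟩⟩,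
    hg.symm⟩

/-! ### Connections, torsion and curvature

Everything below is computed along a local section `s` of `P`. A function `f` on `P` is represented
by `f ∘ s`, a differential form on `P` by the components in the frame `s` of its pullback by `s`. -/

/-- The components of `dθ`, where `θ` is the coframe dual to `s`. This is the torsion
`Θ = dθ + ω ∧ θ` of the connection for which `s` is parallel (`ω = 0`). -/
def dCoframe (s : FrameField M) (x : M) : T [⋀^Fin 2]→L[ℝ] T :=
  dFrame s (fun _ => ContinuousLinearMap.id ℝ T) x

/-- The torsion `Θ = dθ + w ∧ θ` of the connection with connection form `w`, taking values
in `so(6)`. -/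
def torsion (s : FrameField M) (w : M → T →L[ℝ] so6) (x : M) : T [⋀^Fin 2]→L[ℝ] T :=
  dCoframe s x + delta (w x)

/-- The intrinsic torsion `τ : P → T* ⊗ so(3)^⊥`: the component in
`Λ²T* ⊗ T ≅ T* ⊗ so(6) → T* ⊗ so(3)^⊥` of the torsion of any connection on `P` (here of the flat
one given by `s`; see `intrinsicTorsion_eq`). -/
def intrinsicTorsion (s : FrameField M) (x : M) : TorsionSpace :=
  projPerp ∘L deltaEquiv.symm (dCoframe s x)

/-- The connection form `ω^{so(6)}` of the Levi-Civita connection of the metric for which the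
frames in `P` are orthonormal: the unique `so(6)`-valued solution of `dθ + ω ∧ θ = 0`. -/
def leviCivitaForm (s : FrameField M) (x : M) : T →L[ℝ] so6 :=
  -deltaEquiv.symm (dCoframe s x)

/-- The connection form `ω` of the canonical connection: the unique connection on `P` with
torsion `∂(τ)`. It is the orthogonal projection of `ω^{so(6)}` onto `so(3)`. -/
def canonicalForm (s : FrameField M) (x : M) : T →L[ℝ] so3 :=
  projSo3 ∘L leviCivitaForm s x

theorem torsion_leviCivita (s : FrameField M) (x : M) : torsion s (leviCivitaForm s) x = 0 := by
  rw [torsion, leviCivitaForm, delta_neg_symm, add_neg_cancel]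

theorem leviCivita_unique (s : FrameField M) (w : M → T →L[ℝ] so6) (x : M)
    (h : torsion s w x = 0) : w x = leviCivitaForm s x :=
  delta_injective (add_left_cancel (h.trans (torsion_leviCivita s x).symm))

theorem intrinsicTorsion_eq (s : FrameField M) (w : M → T →L[ℝ] so3) (x : M) :
    projPerp ∘L deltaEquiv.symm (torsion s (fun y => inclSo3 ∘L w y) x) = intrinsicTorsion s x := by
  have h : deltaEquiv.symm (delta (inclSo3 ∘L w x)) = inclSo3 ∘L w x :=
    deltaEquiv.symm_apply_apply _
  ext1 t
  rw [torsion, map_add, h, ContinuousLinearMap.comp_apply, add_apply, map_add,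
    projPerp_of_mem ((inclSo3 ∘L w x) t) (w x t).2, add_zero]
  rfl

theorem torsion_canonical (s : FrameField M) (x : M) :
    torsion s (fun y => inclSo3 ∘L canonicalForm s y) x
      = delta (inclPerp ∘L intrinsicTorsion s x) := by
  have h : delta (deltaEquiv.symm (dCoframe s x)) = dCoframe s x :=
    deltaEquiv.apply_symm_apply _
  rw [torsion, ← sub_eq_zero, add_sub_assoc, ← map_sub]
  nth_rewrite 1 [← h]
  rw [← map_add]
  refine Eq.trans (congrArg delta ?_) delta.map_zero
  ext t : 1
  refine Subtype.ext ?_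
  have e := projSo3_add_projPerp (deltaEquiv.symm (dCoframe s x) t)
  change (deltaEquiv.symm (dCoframe s x) t : T →L[ℝ] T)
    + ((projSo3 (-(deltaEquiv.symm (dCoframe s x)) t) : T →L[ℝ] T)
      - projPerp (deltaEquiv.symm (dCoframe s x) t)) = 0
  have n : (projSo3 (-(deltaEquiv.symm (dCoframe s x)) t) : T →L[ℝ] T)
      = -(projSo3 (deltaEquiv.symm (dCoframe s x) t) : T →L[ℝ] T) :=
    congrArg Subtype.val (map_neg projSo3 _)
  rw [n]
  nth_rewrite 1 [← e]
  abel

theorem canonical_unique (s : FrameField M) (w : M → T →L[ℝ] so3) (x : M)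
    (h : torsion s (fun y => inclSo3 ∘L w y) x = delta (inclPerp ∘L intrinsicTorsion s x)) :
    w x = canonicalForm s x := by
  have := delta_injective (add_left_cancel (h.trans (torsion_canonical s x).symm))
  ext t : 2
  exact congrArg (fun a : T →L[ℝ] so6 => (a t : T →L[ℝ] T)) this

/-- The curvature `Ω^{so(6)} = dω + ½ [ω ∧ ω]` of the Levi-Civita connection. -/
def leviCivitaCurvature (s : FrameField M) (x : M) : TwoForms so6 :=
  dFrame (F := so6) s (leviCivitaForm s) x
    + (1 / 2 : ℝ) • bracketWedge comm_so6 (leviCivitaForm s x) (leviCivitaForm s x)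

/-- The curvature `Ω = dω + ½ [ω ∧ ω]` of the canonical connection. -/
def canonicalCurvature (s : FrameField M) (x : M) : TwoForms so3 :=
  dFrame (F := so3) s (canonicalForm s) x
    + (1 / 2 : ℝ) • bracketWedge comm_so3 (canonicalForm s x) (canonicalForm s x)

/-- `Dτ = dτ + [ω ∧ τ]`: the exterior covariant derivative, with respect to the canonical
connection, of `τ` regarded as an `so(3)^⊥`-valued 1-form. -/
def covTorsion (s : FrameField M) (x : M) : TwoForms so3perp :=
  dFrame (F := so3perp) s (intrinsicTorsion s) x
    + bracketWedge comm_so3perp (canonicalForm s x) (intrinsicTorsion s x)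

/-- The structure `P` is torsion-free if its intrinsic torsion vanishes on all of `P`. -/
def SO3Structure.TorsionFree [IsManifold (𝓡 6) ∞ M] (P : SO3Structure M) : Prop :=
  ∀ U s, P.IsLocalSection U s → ∀ x ∈ U, intrinsicTorsion s x = 0

/-- The structure `P` is flat if the curvatures of the Levi-Civita connection of its metric and of
its canonical connection vanish. -/
def SO3Structure.IsFlat [IsManifold (𝓡 6) ∞ M] (P : SO3Structure M) : Prop :=
  ∀ U s, P.IsLocalSection U s → ∀ x ∈ U, leviCivitaCurvature s x = 0 ∧ canonicalCurvature s x = 0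

end Manifold

end SO3Geom

end

noncomputable section

namespace SO3Geom

/-! Along a local section, the Levi-Civita form is `ω - τ`, where `ω` is the canonical form.
Expanding its curvature gives `Ω = K + Dτ - ½[τ ∧ τ]`, where `Ω` is the canonical and `K` the
Levi-Civita curvature (`inclSo3_canonicalCurvature`). The correction term is a linear equivariant
function `curvDiff` of `(τ ⊗ τ, Dτ)`, so it remains to recover `Ω` from it.

Two facts separate `Ω` from `K`. First, `K` satisfies the first Bianchi identity, by differentiating
`dθ + ω ∧ θ = 0` (`bianchi_leviCivitaCurvature`). Second, no nonzero element of `Λ²T* ⊗ so(3)`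
satisfies it: the diagonal `so(3)` preserves both copies of `V`, so for vectors taken two from each
copy the Bianchi sum collapses to a single term. This is made effective by an explicit equivariant
map `bianchiProj` that is the identity on `Λ²T* ⊗ so(3)` (`bianchiProj_inclSo3`) and kills every
solution of the Bianchi identity (`bianchiProj_eq_zero`). Applying it to the relation gives `Ω =
bianchiProj (curvDiff (τ ⊗ τ, Dτ))`, and then `K = Ω - curvDiff (τ ⊗ τ, Dτ)`. Both maps are linear
and equivariant, and do not depend on the manifold. If `τ = 0` on `P` then also `Dτ = 0`, and both
curvatures vanish.

The analytic part reads all forms in one fixed chart. This is needed because `extD` uses a different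
chart at each point, while the Bianchi identity differentiates the structure equation on a
neighbourhood. -/

instance (𝔞 : Submodule ℝ (T →L[ℝ] T)) : AddCommGroup (TwoForms 𝔞) :=
  ContinuousAlternatingMap.instAddCommGroup

instance (𝔞 : Submodule ℝ (T →L[ℝ] T)) : Module ℝ (TwoForms 𝔞) :=
  ContinuousAlternatingMap.instModule

/-! ### Quadrilinear forms of curvature type -/

/-- The quadrilinear form `⟨K(x, y) z, w⟩` of `K ∈ Λ²T* ⊗ so(6)`. -/
def quad (K : TwoForms so6) (x y z w : T) : ℝ := ⟪(K ![x, y] : T →L[ℝ] T) z, w⟫_ℝ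

section Quad

variable (K L : TwoForms so6) (c : ℝ) (x x' y y' z z' w w' : T)

theorem quad_swap_left : quad K y x z w = -quad K x y z w := by
  rw [quad, quad]
  have h := K.toAlternatingMap.map_swap ![x, y] (i := 0) (j := 1) (by decide)
  have e : (![x, y] ∘ (Equiv.swap (0 : Fin 2) 1)) = ![y, x] := by
    funext i; fin_cases i <;> simp
  rw [e] at h
  have h' : K ![y, x] = -K ![x, y] := h
  rw [h', Submodule.coe_neg, neg_apply, inner_neg_left]

theorem quad_swap_right : quad K x y w z = -quad K x y z w := by
  rw [quad, quad, (K ![x, y]).2, real_inner_comm]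

theorem quad_add_form : quad (K + L) x y z w = quad K x y z w + quad L x y z w := by
  simp [quad, inner_add_left]

theorem quad_smul_form : quad (c • K) x y z w = c * quad K x y z w := by
  simp [quad, inner_smul_left]

theorem quad_add₁ : quad K (x + x') y z w = quad K x y z w + quad K x' y z w := by
  have h : K ![x + x', y] = K ![x, y] + K ![x', y] := K.vecCons_add ![y] x x'
  rw [quad, h, Submodule.coe_add, add_apply, inner_add_left, quad, quad]

theorem quad_smul₁ : quad K (c • x) y z w = c * quad K x y z w := by
  have h : K ![c • x, y] = c • K ![x, y] := K.vecCons_smul ![y] c x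
  rw [quad, h, Submodule.coe_smul, smul_apply, real_inner_smul_left, quad]

theorem quad_add₂ : quad K x (y + y') z w = quad K x y z w + quad K x y' z w := by
  rw [quad_swap_left, quad_add₁, quad_swap_left K x y, quad_swap_left K x y']; ring

theorem quad_smul₂ : quad K x (c • y) z w = c * quad K x y z w := by
  rw [quad_swap_left, quad_smul₁, quad_swap_left K x y]; ring

theorem quad_add₃ : quad K x y (z + z') w = quad K x y z w + quad K x y z' w := by
  rw [quad, map_add, inner_add_left, quad, quad]

theorem quad_smul₃ : quad K x y (c • z) w = c * quad K x y z w := by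
  rw [quad, map_smul, real_inner_smul_left, quad]

theorem quad_add₄ : quad K x y z (w + w') = quad K x y z w + quad K x y z w' := by
  rw [quad, inner_add_right, quad, quad]

theorem quad_smul₄ : quad K x y z (c • w) = c * quad K x y z w := by
  rw [quad, real_inner_smul_right, quad]

/-- The quadrilinear form of the Bianchi sum `K(x, y) z + K(y, z) x + K(z, x) y`. -/
def bianchiForm : ℝ := quad K x y z w + quad K y z x w + quad K z x y w

variable {K} in
/-- A two-form satisfying the first Bianchi identity is symmetric under exchange of pairs. -/
theorem quad_pair_symm (h : ∀ x y z w, bianchiForm K x y z w = 0) :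
    quad K x y z w = quad K z w x y := by
  -- After ordering the arguments within each pair by skewness, each of the six pairings occurs in
  -- exactly two of these four cyclic sums. With signs `+, -, -, +` (and the second and fourth sums
  -- negated) only twice the desired difference survives.
  have h₁ := h x y z w
  have h₂ := h y z w x
  have h₃ := h z w x y
  have h₄ := h w x y z
  simp only [bianchiForm] at h₁ h₂ h₃ h₄
  have l := quad_swap_left K
  have r := quad_swap_right K
  linarith [l x y z w, l y z x w, l z x y w, l y z w x, l z w y x, l w y z x, l z w x y, l w x z y,
    l x z w y, l w x y z, l x y w z, l y w x z, r x y z w, r y z x w, r z x y w, r z w x y,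
    r w x y z, r y w z x, r x z w y, r w y z x, r y z w x, r x y w z, r z w y x, r w x z y,
    r x z y w, r y w x z]

end Quad

/-! ### An equivariant projection `Λ²T* ⊗ so(6) → Λ²T* ⊗ so(3)` killing the solutions of the
first Bianchi identity -/

/-- The endomorphism of `V` with matrix entries `f e_a e_b`. -/
def opOf : (V → V → ℝ) →ₗ[ℝ] (V →L[ℝ] V) where
  toFun f := Matrix.toEuclideanCLM (n := Fin 3) (𝕜 := ℝ)
    (Matrix.of fun b a => f (EuclideanSpace.single a 1) (EuclideanSpace.single b 1))
  map_add' f g := by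
    rw [← map_add]; rfl
  map_smul' c f := by
    rw [← map_smul]; rfl

/-- `opOf` accepts arbitrary functions, so it is linear on a full function space; it represents `f`
only when `f` is bilinear. The row index is the second argument of `f`, which makes the pairing come
out as `⟪A z, w⟫` without a transpose. -/
theorem inner_opOf (B : V →ₗ[ℝ] V →ₗ[ℝ] ℝ) (z w : V) :
    ⟪opOf (fun z w => B z w) z, w⟫_ℝ = B z w := by
  have hz : z = ∑ a, z a • EuclideanSpace.single a (1 : ℝ) := by
    ext i; simp [Finset.sum_apply, Pi.single_apply]
  have hw : w = ∑ a, w a • EuclideanSpace.single a (1 : ℝ) := by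
    ext i; simp [Finset.sum_apply, Pi.single_apply]
  have hB : B z w = ∑ a, ∑ b, z a * (w b * B (EuclideanSpace.single a 1)
      (EuclideanSpace.single b 1)) := by
    conv_lhs => rw [hz, hw]
    simp only [map_sum, LinearMap.sum_apply, map_smul, LinearMap.smul_apply, smul_eq_mul,
      Finset.mul_sum]
    rw [Finset.sum_comm]
    exact Finset.sum_congr rfl fun a _ => Finset.sum_congr rfl fun b _ => by ring
  rw [hB, PiLp.inner_apply, Finset.sum_comm]
  refine Finset.sum_congr rfl fun b _ => ?_
  simp only [opOf, LinearMap.coe_mk, AddHom.coe_mk, Matrix.ofLp_toEuclideanCLM,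
    Matrix.mulVec, dotProduct, Matrix.of_apply]
  simp only [RCLike.inner_apply, conj_trivial, Finset.mul_sum]
  refine Finset.sum_congr rfl fun a _ => ?_
  ring

/-- The form whose alternation in `x`, `y` is the form of the projection of `K` to
`Λ²T* ⊗ so(3)`. -/
def projForm (K : TwoForms so6) (x y : T) (z w : V) : ℝ :=
  -- The factor `1/4` undoes two doublings on forms with values in `so(3)`: one from skewing in `z,
  -- w` here, one from the later alternation in `x, y`.
  (1 / 4 : ℝ) * (bianchiForm K (inl (fstL x)) (inl (fstL y)) (inr z) (inr w)
      - bianchiForm K (inl (fstL x)) (inl (fstL y)) (inr w) (inr z))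
    + (1 / 4 : ℝ) * (bianchiForm K (inr (sndL x)) (inr (sndL y)) (inl z) (inl w)
      - bianchiForm K (inr (sndL x)) (inr (sndL y)) (inl w) (inl z))
    -- The mixed components in `x, y` are read off directly. The subtracted term is zero for a form
    -- with values in the diagonal `so(3)`, and it cancels the first one when `K` has pair symmetry.
    + (quad K (inl (fstL x)) (inr (sndL y)) (inl z) (inl w)
      - quad K (inl z) (inl w) (inl (fstL x)) (inr (sndL y)))

/-- Used twice: it transfers linearity from `z` to `w`, and it puts the resulting operator in
`so(3)`. -/
theorem projForm_skew (K : TwoForms so6) (x y : T) (z w : V) :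
    projForm K x y w z = -projForm K x y z w := by
  simp only [projForm]
  rw [quad_swap_right K _ _ (inl z) (inl w), quad_swap_left K (inl z) (inl w)]
  ring

/-- `projForm` as a bilinear form in its last two arguments. -/
def projBilin (K : TwoForms so6) (x y : T) : V →ₗ[ℝ] V →ₗ[ℝ] ℝ :=
  have add : ∀ z z' w, projForm K x y (z + z') w = projForm K x y z w + projForm K x y z' w := by
    intro z z' w
    simp only [projForm, bianchiForm, map_add, quad_add₁, quad_add₂, quad_add₃, quad_add₄]
    ring
  have smul : ∀ (c : ℝ) z w, projForm K x y (c • z) w = c * projForm K x y z w := by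
    intro c z w
    simp only [projForm, bianchiForm, map_smul, quad_smul₁, quad_smul₂, quad_smul₃, quad_smul₄]
    ring
  LinearMap.mk₂ ℝ (projForm K x y) add smul
    (fun z w w' => by
      rw [projForm_skew, add, neg_add, ← projForm_skew, ← projForm_skew])
    (fun c z w => by
      rw [projForm_skew, smul, ← mul_neg, ← projForm_skew]; rfl)

theorem inner_opOf_projForm (K : TwoForms so6) (x y : T) (z w : V) :
    ⟪opOf (projForm K x y) z, w⟫_ℝ = projForm K x y z w :=
  inner_opOf (projBilin K x y) z w

/-- The endomorphism with form `projForm K x y`, as an element of `so(3)`. -/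
def projOp (K : TwoForms so6) (x y : T) : so3 :=
  ⟨diag (opOf (projForm K x y)), opOf (projForm K x y), fun z w => by
    rw [inner_opOf_projForm, projForm_skew, ← inner_opOf_projForm, real_inner_comm], rfl⟩

/-- All three triples of arguments are independent, so that the same statement yields additivity in
`K`, in `x` and in `y`. -/
theorem projOp_add {K₁ K₂ K₃ : TwoForms so6} {x₁ x₂ x₃ y₁ y₂ y₃ : T}
    (h : ∀ z w, projForm K₁ x₁ y₁ z w = projForm K₂ x₂ y₂ z w + projForm K₃ x₃ y₃ z w) :
    projOp K₁ x₁ y₁ = projOp K₂ x₂ y₂ + projOp K₃ x₃ y₃ := by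
  have e : projForm K₁ x₁ y₁ = projForm K₂ x₂ y₂ + projForm K₃ x₃ y₃ := by
    funext z w; exact h z w
  refine Subtype.ext ?_
  change diagₗ (opOf _) = diagₗ (opOf _) + diagₗ (opOf _)
  rw [e, map_add, map_add]

theorem projOp_smul {K₁ K₂ : TwoForms so6} {x₁ x₂ y₁ y₂ : T} {c : ℝ}
    (h : ∀ z w, projForm K₁ x₁ y₁ z w = c * projForm K₂ x₂ y₂ z w) :
    projOp K₁ x₁ y₁ = c • projOp K₂ x₂ y₂ := by
  have e : projForm K₁ x₁ y₁ = c • projForm K₂ x₂ y₂ := by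
    funext z w; exact h z w
  refine Subtype.ext ?_
  change diagₗ (opOf _) = c • diagₗ (opOf _)
  rw [e, map_smul, map_smul]

/-- An equivariant projection `Λ²T* ⊗ so(6) → Λ²T* ⊗ so(3)` which vanishes on the solutions of the
first Bianchi identity. -/
def bianchiProj : TwoForms so6 →ₗ[ℝ] TwoForms so3 where
  toFun K := alt2 (LinearMap.toContinuousBilinearMap
    (LinearMap.mk₂ ℝ (projOp K)
      (fun x x' y => projOp_add fun z w => by
        simp only [projForm, bianchiForm, map_add, quad_add₁, quad_add₂, quad_add₃]; ring)
      (fun c x y => projOp_smul fun z w => by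
        simp only [projForm, bianchiForm, map_smul, quad_smul₁, quad_smul₂, quad_smul₃]; ring)
      (fun x y y' => projOp_add fun z w => by
        simp only [projForm, bianchiForm, map_add, quad_add₁, quad_add₂, quad_add₃, quad_add₄]
        ring)
      (fun c x y => projOp_smul fun z w => by
        simp only [projForm, bianchiForm, map_smul, quad_smul₁, quad_smul₂, quad_smul₃, quad_smul₄]
        ring)))
  map_add' K L := by
    have h : ∀ x y, projOp (K + L) x y = projOp K x y + projOp L x y := fun x y =>
      projOp_add fun z w => by simp only [projForm, bianchiForm, quad_add_form]; ring
    refine ContinuousAlternatingMap.ext fun v => ?_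
    change projOp (K + L) (v 0) (v 1) - projOp (K + L) (v 1) (v 0)
      = (projOp K (v 0) (v 1) - projOp K (v 1) (v 0))
        + (projOp L (v 0) (v 1) - projOp L (v 1) (v 0))
    rw [h, h]; abel
  map_smul' c K := by
    have h : ∀ x y, projOp (c • K) x y = c • projOp K x y := fun x y =>
      projOp_smul fun z w => by simp only [projForm, bianchiForm, quad_smul_form]; ring
    refine ContinuousAlternatingMap.ext fun v => ?_
    change projOp (c • K) (v 0) (v 1) - projOp (c • K) (v 1) (v 0)
      = c • (projOp K (v 0) (v 1) - projOp K (v 1) (v 0))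
    rw [h, h, smul_sub]

theorem inner_bianchiProj (K : TwoForms so6) (v : Fin 2 → T) (z w : V) :
    ⟪fstL ((bianchiProj K v : T →L[ℝ] T) (inl z)), w⟫_ℝ
      = projForm K (v 0) (v 1) z w - projForm K (v 1) (v 0) z w := by
  change ⟪opOf (projForm K (v 0) (v 1)) z - opOf (projForm K (v 1) (v 0)) z, w⟫_ℝ = _
  rw [inner_sub_left, inner_opOf_projForm, inner_opOf_projForm]

/-- An element of `so(3)` is `a ⊕ a`, so its first diagonal block determines it. -/
theorem so3_ext {A B : so3}
    (h : ∀ z w : V, ⟪fstL ((A : T →L[ℝ] T) (inl z)), w⟫_ℝ = ⟪fstL ((B : T →L[ℝ] T) (inl z)), w⟫_ℝ) :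
    A = B := by
  obtain ⟨_, a, ha, rfl⟩ := A
  obtain ⟨_, b, hb, rfl⟩ := B
  have e : a = b := ContinuousLinearMap.ext fun z => ext_inner_right ℝ fun w => h z w
  subst e; rfl

/-- The first two groups of terms in `projForm` are Bianchi sums; the last is a failure of pair
symmetry, which the Bianchi identity excludes. -/
theorem bianchiProj_eq_zero {K : TwoForms so6} (h : ∀ x y z w, bianchiForm K x y z w = 0) :
    bianchiProj K = 0 := by
  refine ContinuousAlternatingMap.ext fun v => so3_ext fun z w => ?_
  rw [inner_bianchiProj]
  simp only [projForm, h]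
  rw [quad_pair_symm (inl z) (inl w) _ _ h, quad_pair_symm (inl z) (inl w) _ _ h]
  simp

/-- The inclusions `Λ²T* ⊗ so(3) ⊂ Λ²T* ⊗ so(6)` and `Λ²T* ⊗ so(3)^⊥ ⊂ Λ²T* ⊗ so(6)`. -/
def inclForm {𝔞 : Submodule ℝ (T →L[ℝ] T)} (i : 𝔞 →L[ℝ] so6) : TwoForms 𝔞 →ₗ[ℝ] TwoForms so6 where
  toFun η := i.compContinuousAlternatingMap η
  map_add' η η' := ContinuousAlternatingMap.ext fun v => map_add i (η v) (η' v)
  map_smul' c η := ContinuousAlternatingMap.ext fun v => map_smul i c (η v)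

/-- An endomorphism `a ⊕ a` has no mixed blocks. In the Bianchi sum of `x₁, y₁` from one copy of `V`
and `z₂, w₂` from the other, two of the three terms are mixed, and only `⟪η(x₁, y₁) z, w⟫` remains.
The equality of the two diagonal blocks lets `z, w` lie in whichever copy is convenient. Hence the
three groups of `projForm` return the components of `η` of type `V₁ ∧ V₁`, `V₂ ∧ V₂` and `V₁ ∧ V₂`.
-/
theorem bianchiProj_inclSo3 (η : TwoForms so3) : bianchiProj (inclForm inclSo3 η) = η := by
  have q₁ : ∀ (x y : T) (z w : V), quad (inclForm inclSo3 η) x y (inl z) (inr w) = 0 := by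
    intro x y z w
    obtain ⟨a, ha, e⟩ := (η ![x, y]).2
    change ⟪(η ![x, y] : T →L[ℝ] T) (inl z), inr w⟫_ℝ = 0
    rw [← e, inner_T]
    change ⟪a z, (0 : V)⟫_ℝ + ⟪a 0, w⟫_ℝ = 0
    simp
  have q₂ : ∀ (x y : T) (z w : V), quad (inclForm inclSo3 η) x y (inr z) (inl w) = 0 := by
    intro x y z w
    rw [quad_swap_right, q₁, neg_zero]
  have q₃ : ∀ (x y : T) (z w : V), quad (inclForm inclSo3 η) x y (inl z) (inl w)
      = ⟪fstL ((η ![x, y] : T →L[ℝ] T) (inl z)), w⟫_ℝ := by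
    intro x y z w
    change ⟪(η ![x, y] : T →L[ℝ] T) (inl z), inl w⟫_ℝ = _
    rw [inner_T]
    change _ + ⟪_, (0 : V)⟫_ℝ = _
    rw [inner_zero_right, add_zero]; rfl
  have q₄ : ∀ (x y : T) (z w : V), quad (inclForm inclSo3 η) x y (inr z) (inr w)
      = ⟪fstL ((η ![x, y] : T →L[ℝ] T) (inl z)), w⟫_ℝ := by
    intro x y z w
    obtain ⟨a, ha, e⟩ := (η ![x, y]).2
    change ⟪(η ![x, y] : T →L[ℝ] T) (inr z), inr w⟫_ℝ = _
    rw [← e, inner_T]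
    change ⟪a 0, (0 : V)⟫_ℝ + ⟪a z, w⟫_ℝ = ⟪a z, w⟫_ℝ
    simp
  refine ContinuousAlternatingMap.ext fun v => so3_ext fun z w => ?_
  rw [inner_bianchiProj]
  simp only [projForm, bianchiForm, q₁, q₂]
  -- Splitting both arguments of the form into their components produces the four terms to be
  -- matched with the alternated `projForm`.
  have hv : v = ![inl (fstL (v 0)) + inr (sndL (v 0)), inl (fstL (v 1)) + inr (sndL (v 1))] := by
    funext i
    fin_cases i
    · exact T_ext (add_zero _).symm (zero_add _).symm
    · exact T_ext (add_zero _).symm (zero_add _).symm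
  conv_rhs => rw [hv, ← q₃, quad_add₁, quad_add₂, quad_add₂]
  simp only [q₃, q₄]
  have r : ∀ (x y : T) (z w : V), ⟪fstL ((η ![x, y] : T →L[ℝ] T) (inl w)), z⟫_ℝ
      = -⟪fstL ((η ![x, y] : T →L[ℝ] T) (inl z)), w⟫_ℝ := fun x y z w => by
    rw [← q₃, ← q₃, quad_swap_right]
  have l : ∀ (x y : T) (z w : V), ⟪fstL ((η ![y, x] : T →L[ℝ] T) (inl z)), w⟫_ℝ
      = -⟪fstL ((η ![x, y] : T →L[ℝ] T) (inl z)), w⟫_ℝ := fun x y z w => by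
    rw [← q₃, ← q₃, quad_swap_left]
  simp only [r _ _ z w]
  rw [l (inl (fstL (v 0))) (inl (fstL (v 1))), l (inr (sndL (v 0))) (inr (sndL (v 1))),
    l (inl (fstL (v 1))) (inr (sndL (v 0)))]
  ring

/-! ### Equivariance -/

theorem inclForm_so3_equivariant (g : SO3) (η : TwoForms so3) :
    inclForm inclSo3 (curvRep3 g η) = curvRep6 g (inclForm inclSo3 η) := rfl

theorem inclForm_perp_equivariant (g : SO3) (η : TwoForms so3perp) :
    inclForm inclPerp (perpFormRep g η) = curvRep6 g (inclForm inclPerp η) := rfl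

theorem quad_curvRep6 (g : SO3) (K : TwoForms so6) (x y z w : T) :
    quad (curvRep6 g K) x y z w
      = quad K (rho g⁻¹ x) (rho g⁻¹ y) (rho g⁻¹ z) (rho g⁻¹ w) := by
  have e : (fun i => rho g⁻¹ (![x, y] i)) = ![rho g⁻¹ x, rho g⁻¹ y] := by
    funext i; fin_cases i <;> rfl
  change ⟪rho g ((K (fun i => rho g⁻¹ (![x, y] i)) : T →L[ℝ] T) (rho g⁻¹ z)), w⟫_ℝ = _
  rw [rho_inner, e]; rfl

theorem rho_inl (g : SO3) (z : V) : rho g (inl z) = inl (rhoV g z) :=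
  T_ext rfl (map_zero (rhoV g))

theorem rho_inr (g : SO3) (z : V) : rho g (inr z) = inr (rhoV g z) :=
  T_ext (map_zero (rhoV g)) rfl

theorem projForm_curvRep6 (g : SO3) (K : TwoForms so6) (x y : T) (z w : V) :
    projForm (curvRep6 g K) x y z w
      = projForm K (rho g⁻¹ x) (rho g⁻¹ y) (rhoV g⁻¹ z) (rhoV g⁻¹ w) := by
  have f : ∀ x, rhoV g⁻¹ (fstL x) = fstL (rho g⁻¹ x) := fun _ => rfl
  have s : ∀ x, rhoV g⁻¹ (sndL x) = sndL (rho g⁻¹ x) := fun _ => rfl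
  simp only [projForm, bianchiForm, quad_curvRep6, rho_inl, rho_inr, f, s]

/-- The construction uses only `quad`, the inclusions and the projections of the two copies of `V`.
All are compatible with the diagonal orthogonal action. -/
theorem bianchiProj_equivariant (g : SO3) (K : TwoForms so6) :
    bianchiProj (curvRep6 g K) = curvRep3 g (bianchiProj K) := by
  refine ContinuousAlternatingMap.ext fun v => so3_ext fun z w => ?_
  rw [inner_bianchiProj, projForm_curvRep6, projForm_curvRep6]
  change _ = ⟪rhoV g (fstL ((bianchiProj K (fun i => rho g⁻¹ (v i)) : T →L[ℝ] T)
    (rho g⁻¹ (inl z)))), w⟫_ℝ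
  rw [rhoV_inner, rho_inl, inner_bianchiProj]

/-- The bilinear map `(a, b) ↦ ½ [a ∧ b]` with values in `Λ²T* ⊗ so(6)`. -/
def halfBracket : TorsionSpace →ₗ[ℝ] TorsionSpace →ₗ[ℝ] TwoForms so6 :=
  LinearMap.mk₂ ℝ
    (fun a b => (1 / 2 : ℝ) • bracketWedge comm_so6 (inclPerp ∘L a) (inclPerp ∘L b))
    (fun a a' b => by
      rw [← smul_add]
      refine congrArg _ (ContinuousAlternatingMap.ext fun v => Subtype.ext ?_)
      change ((a (v 0) : T →L[ℝ] T) + a' (v 0)) * b (v 1) - b (v 1) * (a (v 0) + a' (v 0))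
          - ((a (v 1) + a' (v 1)) * b (v 0) - b (v 0) * (a (v 1) + a' (v 1)))
        = (a (v 0) * b (v 1) - b (v 1) * a (v 0) - (a (v 1) * b (v 0) - b (v 0) * a (v 1)))
          + (a' (v 0) * b (v 1) - b (v 1) * a' (v 0) - (a' (v 1) * b (v 0) - b (v 0) * a' (v 1)))
      noncomm_ring)
    (fun c a b => by
      rw [smul_comm]
      refine congrArg _ (ContinuousAlternatingMap.ext fun v => Subtype.ext ?_)
      change (c • (a (v 0) : T →L[ℝ] T)) * b (v 1) - b (v 1) * (c • (a (v 0) : T →L[ℝ] T))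
          - ((c • (a (v 1) : T →L[ℝ] T)) * b (v 0) - b (v 0) * (c • (a (v 1) : T →L[ℝ] T)))
        = c • (a (v 0) * b (v 1) - b (v 1) * a (v 0) - (a (v 1) * b (v 0) - b (v 0) * a (v 1)) :
          T →L[ℝ] T)
      simp only [smul_mul_assoc, mul_smul_comm, smul_sub])
    (fun a b b' => by
      rw [← smul_add]
      refine congrArg _ (ContinuousAlternatingMap.ext fun v => Subtype.ext ?_)
      change (a (v 0) : T →L[ℝ] T) * (b (v 1) + b' (v 1)) - (b (v 1) + b' (v 1)) * a (v 0)
          - (a (v 1) * (b (v 0) + b' (v 0)) - (b (v 0) + b' (v 0)) * a (v 1))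
        = (a (v 0) * b (v 1) - b (v 1) * a (v 0) - (a (v 1) * b (v 0) - b (v 0) * a (v 1)))
          + (a (v 0) * b' (v 1) - b' (v 1) * a (v 0) - (a (v 1) * b' (v 0) - b' (v 0) * a (v 1)))
      noncomm_ring)
    (fun c a b => by
      rw [smul_comm]
      refine congrArg _ (ContinuousAlternatingMap.ext fun v => Subtype.ext ?_)
      change (a (v 0) : T →L[ℝ] T) * (c • (b (v 1) : T →L[ℝ] T)) - (c • (b (v 1) : T →L[ℝ] T)) * a (v 0)
          - (a (v 1) * (c • (b (v 0) : T →L[ℝ] T)) - (c • (b (v 0) : T →L[ℝ] T)) * a (v 1))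
        = c • (a (v 0) * b (v 1) - b (v 1) * a (v 0) - (a (v 1) * b (v 0) - b (v 0) * a (v 1)) :
          T →L[ℝ] T)
      simp only [smul_mul_assoc, mul_smul_comm, smul_sub])

/-- Conjugation by `rho g` is multiplicative, hence preserves commutators. -/
theorem halfBracket_equivariant (g : SO3) (a b : TorsionSpace) :
    halfBracket (torsionRep g a) (torsionRep g b) = curvRep6 g (halfBracket a b) := by
  have h : ∀ A B : T →L[ℝ] T, (rho g * A * rho g⁻¹) * (rho g * B * rho g⁻¹)
      = rho g * (A * B) * rho g⁻¹ := fun A B => by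
    simp only [mul_assoc]
    rw [← mul_assoc (rho g⁻¹) (rho g), rho_inv_mul, one_mul]
  change (1 / 2 : ℝ) • _ = curvRep6 g ((1 / 2 : ℝ) • _)
  rw [map_smul]
  refine congrArg _ (ContinuousAlternatingMap.ext fun v => Subtype.ext ?_)
  change (rho g * (a (rho g⁻¹ (v 0)) : T →L[ℝ] T) * rho g⁻¹)
        * (rho g * (b (rho g⁻¹ (v 1)) : T →L[ℝ] T) * rho g⁻¹)
      - (rho g * (b (rho g⁻¹ (v 1)) : T →L[ℝ] T) * rho g⁻¹)
        * (rho g * (a (rho g⁻¹ (v 0)) : T →L[ℝ] T) * rho g⁻¹)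
      - ((rho g * (a (rho g⁻¹ (v 1)) : T →L[ℝ] T) * rho g⁻¹)
        * (rho g * (b (rho g⁻¹ (v 0)) : T →L[ℝ] T) * rho g⁻¹)
      - (rho g * (b (rho g⁻¹ (v 0)) : T →L[ℝ] T) * rho g⁻¹)
        * (rho g * (a (rho g⁻¹ (v 1)) : T →L[ℝ] T) * rho g⁻¹))
    = rho g * ((a (rho g⁻¹ (v 0)) : T →L[ℝ] T) * (b (rho g⁻¹ (v 1)) : T →L[ℝ] T)
        - (b (rho g⁻¹ (v 1)) : T →L[ℝ] T) * (a (rho g⁻¹ (v 0)) : T →L[ℝ] T)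
        - ((a (rho g⁻¹ (v 1)) : T →L[ℝ] T) * (b (rho g⁻¹ (v 0)) : T →L[ℝ] T)
        - (b (rho g⁻¹ (v 0)) : T →L[ℝ] T) * (a (rho g⁻¹ (v 1)) : T →L[ℝ] T))) * rho g⁻¹
  rw [h, h, h, h]
  simp only [mul_sub, sub_mul]

/-- The linear map `S²(T* ⊗ so(3)^⊥) → Λ²T* ⊗ so(6)` with `τ ⊗ τ ↦ ½ [τ ∧ τ]`. -/
def sqBracket : SymSq TorsionSpace →ₗ[ℝ] TwoForms so6 :=
  TensorProduct.lift halfBracket ∘ₗ (SymSq TorsionSpace).subtype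

theorem sqBracket_equivariant (g : SO3) (σ : SymSq TorsionSpace) :
    sqBracket (symSqRep (W := TorsionSpace) torsionRep g σ) = curvRep6 g (sqBracket σ) := by
  have e : TensorProduct.lift halfBracket ∘ₗ (torsionRep.tprod torsionRep) g
      = curvRep6 g ∘ₗ TensorProduct.lift halfBracket :=
    TensorProduct.ext' fun a b => halfBracket_equivariant g a b
  exact LinearMap.congr_fun e (σ : TorsionSpace ⊗[ℝ] TorsionSpace)

/-! ### The equivariant maps giving the two curvatures -/

/-- `(τ ⊗ τ, η) ↦ η - ½ [τ ∧ τ]`, the difference of the canonical and the Levi-Civita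
curvature. -/
def curvDiff : sourceRep.IntertwiningMap curvRep6 :=
  LinearMap.intertwiningMap_of_isIntertwiningMap sourceRep curvRep6
    (inclForm inclPerp ∘ₗ LinearMap.snd ℝ _ _ - sqBracket ∘ₗ LinearMap.fst ℝ _ _)
    fun g p => by
      change inclForm inclPerp (perpFormRep g p.2)
          - sqBracket (symSqRep (W := TorsionSpace) torsionRep g p.1)
        = curvRep6 g (inclForm inclPerp p.2 - sqBracket p.1)
      rw [sqBracket_equivariant, inclForm_perp_equivariant, map_sub]

/-- The equivariant map expressing the curvature of the canonical connection. -/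
def curvatureMap3 : sourceRep.IntertwiningMap curvRep3 :=
  LinearMap.intertwiningMap_of_isIntertwiningMap sourceRep curvRep3
    (bianchiProj ∘ₗ curvDiff.toLinearMap)
    fun g p => by
      change bianchiProj (curvDiff (sourceRep g p)) = curvRep3 g (bianchiProj (curvDiff p))
      rw [curvDiff.isIntertwining, bianchiProj_equivariant]

/-- The equivariant map expressing the curvature of the Levi-Civita connection. -/
def curvatureMap6 : sourceRep.IntertwiningMap curvRep6 :=
  LinearMap.intertwiningMap_of_isIntertwiningMap sourceRep curvRep6
    (inclForm inclSo3 ∘ₗ curvatureMap3.toLinearMap - curvDiff.toLinearMap)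
    fun g p => by
      have h₃ := (congrArg (inclForm inclSo3) (curvatureMap3.isIntertwining _ _ g p)).trans
        (inclForm_so3_equivariant g (curvatureMap3 p))
      exact (congrArg₂ (· - ·) h₃ (curvDiff.isIntertwining _ _ g p)).trans
        (map_sub (curvRep6 g) _ _).symm

/-- If the curvatures `K ∈ Λ²T* ⊗ so(6)` and `η ∈ Λ²T* ⊗ so(3)` differ by `curvDiff p` and `K`
satisfies the first Bianchi identity, then `p` determines both. -/
theorem curvatureMap_eq {p : SymSq TorsionSpace × TwoForms so3perp} {K : TwoForms so6}
    {η : TwoForms so3} (hd : inclForm inclSo3 η = K + curvDiff p)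
    (hK : ∀ x y z w, bianchiForm K x y z w = 0) :
    curvatureMap6 p = K ∧ curvatureMap3 p = η := by
  have h₃ : curvatureMap3 p = η := by
    -- Projecting the relation fixes `η` and removes `K`, leaving `η` as a function of `p` alone.
    have h := congrArg bianchiProj hd
    rw [bianchiProj_inclSo3, map_add, bianchiProj_eq_zero hK, zero_add] at h
    exact h.symm
  refine ⟨?_, h₃⟩
  change inclForm inclSo3 (curvatureMap3 p) - curvDiff p = K
  rw [h₃]
  exact sub_eq_of_eq_add hd

theorem curvDiff_zero : curvDiff (tsq (0 : TorsionSpace), 0) = 0 := by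
  have h : sqBracket (tsq (0 : TorsionSpace)) = 0 :=
    (congrArg sqBracket (Subtype.ext (TensorProduct.zero_tmul TorsionSpace (0 : TorsionSpace)))).trans
      (map_zero sqBracket)
  exact (congrArg₂ (· - ·) (map_zero (inclForm inclPerp)) h).trans (sub_zero _)

theorem curvatureMap3_zero : curvatureMap3 (tsq (0 : TorsionSpace), 0) = 0 :=
  (congrArg bianchiProj curvDiff_zero).trans (map_zero bianchiProj)

theorem curvatureMap6_zero : curvatureMap6 (tsq (0 : TorsionSpace), 0) = 0 :=
  (congrArg₂ (· - ·) ((congrArg (inclForm inclSo3) curvatureMap3_zero).trans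
    (map_zero (inclForm inclSo3))) curvDiff_zero).trans (sub_zero _)

/-! ### One-forms on a normed space -/

section OneForms

variable {E F : Type*} [NormedAddCommGroup E] [NormedSpace ℝ E]
  [NormedAddCommGroup F] [NormedSpace ℝ F]

theorem hasFDerivAt_ofSubsingleton {a : E → E →L[ℝ] F} {z : E} (h : DifferentiableAt ℝ a z) :
    HasFDerivAt (fun z => ContinuousAlternatingMap.ofSubsingleton ℝ E F (0 : Fin 1) (a z))
      ((ContinuousAlternatingMap.ofSubsingletonLIE (𝕜 := ℝ) (E := E) (F := F)
        (0 : Fin 1)).toContinuousLinearEquiv.toContinuousLinearMap ∘L fderiv ℝ a z) z := by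
  have := (ContinuousAlternatingMap.ofSubsingletonLIE (𝕜 := ℝ) (E := E) (F := F)
    (0 : Fin 1)).toContinuousLinearEquiv.toContinuousLinearMap.hasFDerivAt.comp z h.hasFDerivAt
  exact this

theorem extDeriv_ofSubsingleton {a : E → E →L[ℝ] F} {z : E} (h : DifferentiableAt ℝ a z)
    (v : Fin 2 → E) :
    extDeriv (fun z => ContinuousAlternatingMap.ofSubsingleton ℝ E F (0 : Fin 1) (a z)) z v
      = fderiv ℝ a z (v 0) (v 1) - fderiv ℝ a z (v 1) (v 0) := by
  rw [extDeriv, (hasFDerivAt_ofSubsingleton h).fderiv,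
    ContinuousAlternatingMap.alternatizeUncurryFin_apply, Fin.sum_univ_two]
  have e₀ : Fin.removeNth 0 v = ![v 1] := by
    funext i; fin_cases i; rfl
  have e₁ : Fin.removeNth 1 v = ![v 0] := by
    funext i; fin_cases i; rfl
  rw [e₀, e₁, sub_eq_add_neg]
  simp

/-- The first Bianchi identity: if `dθ + ω ∧ θ = 0` near `z` then `(dω + ½ [ω ∧ ω]) ∧ θ = 0`
at `z`. The connection form takes values in a space `F` of endomorphisms of `G`. -/
theorem bianchi_of_structure_equation {G : Type*} [NormedAddCommGroup G] [NormedSpace ℝ G]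
    (i : F →L[ℝ] G →L[ℝ] G) {θ : E → E →L[ℝ] G} {w : E → E →L[ℝ] F} {z : E}
    (hθ : ContDiffAt ℝ ∞ θ z) (hw : DifferentiableAt ℝ w z)
    (h : ∀ᶠ y in 𝓝 z, ∀ u v, fderiv ℝ θ y u v - fderiv ℝ θ y v u
      = i (w y v) (θ y u) - i (w y u) (θ y v))
    {Ω : E → E → G →L[ℝ] G}
    (hΩ : ∀ u v, Ω u v = i (fderiv ℝ w z u v) - i (fderiv ℝ w z v u)
      + (i (w z u) * i (w z v) - i (w z v) * i (w z u)))
    (u v k : E) : Ω u v (θ z k) + Ω v k (θ z u) + Ω k u (θ z v) = 0 := by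
  have hθ' : DifferentiableAt ℝ θ z := hθ.differentiableAt (by simp)
  have h₂ : (2 : WithTop ℕ∞) ≤ ∞ := WithTop.coe_le_coe.2 (le_top : (2 : ℕ∞) ≤ ⊤)
  have hD : DifferentiableAt ℝ (fderiv ℝ θ) z :=
    (hθ.fderiv_right (m := 1) (by simpa [one_add_one_eq_two] using h₂)).differentiableAt one_ne_zero
  -- This symmetry is `d²θ = 0`; it is the reason `θ` is required to be smoother than `w`.
  have hsym : ∀ a b, fderiv ℝ (fderiv ℝ θ) z a b = fderiv ℝ (fderiv ℝ θ) z b a := fun a b =>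
    (hθ.isSymmSndFDerivAt (by simpa using h₂)).eq a b
  have hL := fun a b =>
    (hD.hasFDerivAt.clm_apply (hasFDerivAt_const a z)).clm_apply (hasFDerivAt_const b z)
  have hw' : ∀ a, HasFDerivAt (fun y => i (w y a))
      (i ∘L (w z ∘L (0 : E →L[ℝ] E) + (fderiv ℝ w z).flip a)) z := fun a =>
    (i.hasFDerivAt (x := w z a)).comp z (hw.hasFDerivAt.clm_apply (hasFDerivAt_const a z))
  have hR := fun a b =>
    (hw' a).clm_apply (hθ'.hasFDerivAt.clm_apply (hasFDerivAt_const b z))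
  -- The structure equation on the constant vectors `a, b`, differentiated in the direction `c`.
  have key : ∀ a b c, fderiv ℝ (fderiv ℝ θ) z c a b - fderiv ℝ (fderiv ℝ θ) z c b a
      = (i (w z b) (fderiv ℝ θ z c a) + i (fderiv ℝ w z c b) (θ z a))
        - (i (w z a) (fderiv ℝ θ z c b) + i (fderiv ℝ w z c a) (θ z b)) := by
    intro a b c
    have e := Filter.EventuallyEq.fderiv_eq (𝕜 := ℝ) (h.mono fun y hy => hy a b)
    rw [((hL a b).fun_sub (hL b a)).fderiv, ((hR b a).fun_sub (hR a b)).fderiv] at e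
    simpa using congrArg (fun f : E →L[ℝ] G => f c) e
  have s := h.self_of_nhds
  -- The undifferentiated structure equation swaps the arguments of `fderiv ℝ θ z` at the cost of
  -- terms quadratic in `w`; these become the commutator part of the curvature.
  have s' : ∀ a b c, i (w z c) (fderiv ℝ θ z a b)
      = i (w z c) (fderiv ℝ θ z b a)
        + (i (w z c) (i (w z b) (θ z a))
          - i (w z c) (i (w z a) (θ z b))) := by
    intro a b c
    rw [← map_sub, ← map_add, ← s a b, add_sub_cancel]
  have k₁ := key u v k
  have k₂ := key v k u
  have k₃ := key k u v
  rw [s' k u v, s' k v u, hsym k u, hsym k v] at k₁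
  rw [s' u v k, hsym u v] at k₂
  simp only [hΩ, add_apply, sub_apply, mul_apply_eq_comp]
  -- In the cyclic sum the second derivatives of `θ` cancel, and so do the terms with one derivative
  -- of `θ`. What is left is the curvature applied to `θ`.
  linear_combination (norm := module) k₁ + k₂ + k₃

end OneForms

/-! ### One-forms and frames in a chart -/

section Charts

variable {M : Type*} [TopologicalSpace M] [ChartedSpace E6 M]
  {F : Type*} [NormedAddCommGroup F] [NormedSpace ℝ F]

/-- The differential at `x` of the preferred chart at `m`. -/
def dchart (m x : M) : TangentSpace (𝓡 6) x →L[ℝ] E6 :=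
  mfderiv (𝓡 6) 𝓘(ℝ, E6) (extChartAt (𝓡 6) m) x

/-- The differential at `z` of the inverse of the preferred chart at `m`. -/
def dchartSymm (m : M) (z : E6) :
    E6 →L[ℝ] TangentSpace (𝓡 6) ((extChartAt (𝓡 6) m).symm z) :=
  mfderiv 𝓘(ℝ, E6) (𝓡 6) (extChartAt (𝓡 6) m).symm z

/-- The one-form `α` in the preferred chart at `m`. -/
def chartCoeff (α : ∀ x : M, TangentSpace (𝓡 6) x →L[ℝ] F) (m : M) (z : E6) : E6 →L[ℝ] F :=
  α ((extChartAt (𝓡 6) m).symm z) ∘L dchartSymm m z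

theorem chartForm_eq (α : ∀ x : M, TangentSpace (𝓡 6) x →L[ℝ] F) (m : M) :
    chartForm α m
      = fun z => ContinuousAlternatingMap.ofSubsingleton ℝ E6 F (0 : Fin 1) (chartCoeff α m z) :=
  rfl

/-- The frame `s` in the preferred chart at `m`. -/
def frameMap (s : FrameField M) (m x : M) : T →L[ℝ] E6 :=
  dchart m x ∘L (s x : T →L[ℝ] TangentSpace (𝓡 6) x)

/-- The coframe dual to `s` in the preferred chart at `m`. -/
def coframe (s : FrameField M) (m : M) (z : E6) : E6 →L[ℝ] T :=
  ((s ((extChartAt (𝓡 6) m).symm z)).symm : TangentSpace (𝓡 6) _ →L[ℝ] T) ∘L dchartSymm m z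

theorem chartCoeff_formOf (s : FrameField M) (a : M → T →L[ℝ] F) (m : M) (z : E6) :
    chartCoeff (formOf s a) m z = a ((extChartAt (𝓡 6) m).symm z) ∘L coframe s m z := rfl

theorem chartCoeff_coframe (s : FrameField M) (m : M) :
    chartCoeff (formOf s fun _ => ContinuousLinearMap.id ℝ T) m = coframe s m := rfl

theorem eventually_chart_overlap {m y : M} (hy : y ∈ (extChartAt (𝓡 6) m).source) :
    ∀ᶠ z in 𝓝 (extChartAt (𝓡 6) y y), z ∈ (extChartAt (𝓡 6) y).target ∧
      (extChartAt (𝓡 6) y).symm z ∈ (extChartAt (𝓡 6) m).source := by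
  refine Filter.Eventually.and (extChartAt_target_mem_nhds (I := 𝓡 6) y) ?_
  have h := (continuousAt_extChartAt_symm (I := 𝓡 6) y)
  refine h.preimage_mem_nhds ?_
  rw [extChartAt_to_inv]
  exact (isOpen_extChartAt_source (I := 𝓡 6) m).mem_nhds hy

variable [IsManifold (𝓡 6) ∞ M]

theorem dchart_comp_dchartSymm {m : M} {z : E6} (hz : z ∈ (extChartAt (𝓡 6) m).target) :
    dchart m ((extChartAt (𝓡 6) m).symm z) ∘L dchartSymm m z = ContinuousLinearMap.id ℝ E6 := by
  have h := mfderiv_extChartAt_comp_mfderivWithin_extChartAt_symm (I := 𝓡 6) hz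
  rw [ModelWithCorners.range_eq_univ, mfderivWithin_univ] at h
  exact h

theorem dchartSymm_comp_dchart {m : M} {z : E6} (hz : z ∈ (extChartAt (𝓡 6) m).target) :
    dchartSymm m z ∘L dchart m ((extChartAt (𝓡 6) m).symm z) = ContinuousLinearMap.id ℝ _ := by
  have h := mfderivWithin_extChartAt_symm_comp_mfderiv_extChartAt (I := 𝓡 6) hz
  rw [ModelWithCorners.range_eq_univ, mfderivWithin_univ] at h
  exact h

theorem chartCoeff_comp_dchart (α : ∀ x : M, TangentSpace (𝓡 6) x →L[ℝ] F) {m x : M}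
    (hx : x ∈ (extChartAt (𝓡 6) m).source) :
    chartCoeff α m (extChartAt (𝓡 6) m x) ∘L dchart m x = α x := by
  have h : ∀ z ∈ (extChartAt (𝓡 6) m).target,
      chartCoeff α m z ∘L dchart m ((extChartAt (𝓡 6) m).symm z)
        = α ((extChartAt (𝓡 6) m).symm z) := fun z hz => by
    rw [chartCoeff, ContinuousLinearMap.comp_assoc, dchartSymm_comp_dchart hz,
      ContinuousLinearMap.comp_id]
  have := h _ ((extChartAt (𝓡 6) m).map_source hx)
  rwa [(extChartAt (𝓡 6) m).left_inv hx] at this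

theorem coframe_comp_frameMap (s : FrameField M) {m : M} {z : E6}
    (hz : z ∈ (extChartAt (𝓡 6) m).target) :
    coframe s m z ∘L frameMap s m ((extChartAt (𝓡 6) m).symm z) = ContinuousLinearMap.id ℝ T := by
  ext1 t
  have h := congrArg (fun f => f (s ((extChartAt (𝓡 6) m).symm z) t)) (dchartSymm_comp_dchart hz)
  change (s ((extChartAt (𝓡 6) m).symm z)).symm (dchartSymm m z (dchart m _ (s _ t))) = t
  exact (congrArg _ h).trans ((s _).symm_apply_apply t)

theorem frameMap_comp_coframe (s : FrameField M) {m : M} {z : E6}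
    (hz : z ∈ (extChartAt (𝓡 6) m).target) :
    frameMap s m ((extChartAt (𝓡 6) m).symm z) ∘L coframe s m z
      = ContinuousLinearMap.id ℝ E6 := by
  ext1 u
  have h := congrArg (fun f => f u) (dchart_comp_dchartSymm hz)
  change dchart m _ (s ((extChartAt (𝓡 6) m).symm z)
    ((s ((extChartAt (𝓡 6) m).symm z)).symm (dchartSymm m z u))) = u
  rw [(s _).apply_symm_apply]
  exact h

theorem extChartAt_symm_mdifferentiableAt {m : M} {z : E6}
    (hz : z ∈ (extChartAt (𝓡 6) m).target) :
    MDifferentiableAt 𝓘(ℝ, E6) (𝓡 6) (extChartAt (𝓡 6) m).symm z := by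
  have h := mdifferentiableWithinAt_extChartAt_symm (I := 𝓡 6) hz
  rwa [ModelWithCorners.range_eq_univ, mdifferentiableWithinAt_univ] at h

theorem dchart_comp_dchartSymm_eq_fderiv {m y : M} {z : E6}
    (hz : z ∈ (extChartAt (𝓡 6) y).target)
    (hm : (extChartAt (𝓡 6) y).symm z ∈ (extChartAt (𝓡 6) m).source) :
    dchart m ((extChartAt (𝓡 6) y).symm z) ∘L dchartSymm y z
      = fderiv ℝ (extChartAt (𝓡 6) m ∘ (extChartAt (𝓡 6) y).symm) z := by
  have hm' : (extChartAt (𝓡 6) y).symm z ∈ (chartAt E6 m).source := by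
    rwa [← extChartAt_source (𝓡 6)]
  have h := mfderiv_comp (I := 𝓘(ℝ, E6)) (I' := 𝓡 6) (I'' := 𝓘(ℝ, E6)) z
    (mdifferentiableAt_extChartAt hm') (extChartAt_symm_mdifferentiableAt hz)
  rw [mfderiv_eq_fderiv] at h
  exact h.symm

theorem contDiffAt_chart_transition {m y : M} {z : E6}
    (hz : z ∈ (extChartAt (𝓡 6) y).target)
    (hm : (extChartAt (𝓡 6) y).symm z ∈ (extChartAt (𝓡 6) m).source) :
    ContDiffAt ℝ ∞ (extChartAt (𝓡 6) m ∘ (extChartAt (𝓡 6) y).symm) z := by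
  have h := contDiffWithinAt_ext_coord_change (I := 𝓡 6) (n := ∞) m y (y := z)
    (by rw [PartialEquiv.trans_source]; exact ⟨hz, hm⟩)
  rwa [ModelWithCorners.range_eq_univ, contDiffWithinAt_univ] at h

/-- The exterior derivative of a one-form at `y` can be computed in any chart around `y`. -/
theorem extD_apply (α : ∀ x : M, TangentSpace (𝓡 6) x →L[ℝ] F) {m y : M}
    (hy : y ∈ (extChartAt (𝓡 6) m).source)
    (hα : DifferentiableAt ℝ (chartCoeff α m) (extChartAt (𝓡 6) m y))
    (v : Fin 2 → TangentSpace (𝓡 6) y) :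
    extD α y v
      = fderiv ℝ (chartCoeff α m) (extChartAt (𝓡 6) m y) (dchart m y (v 0)) (dchart m y (v 1))
        - fderiv ℝ (chartCoeff α m) (extChartAt (𝓡 6) m y) (dchart m y (v 1))
          (dchart m y (v 0)) := by
  set ψ : E6 → E6 := extChartAt (𝓡 6) m ∘ (extChartAt (𝓡 6) y).symm with hψ
  set z := extChartAt (𝓡 6) y y with hz
  have hψz : ψ z = extChartAt (𝓡 6) m y := by simp [ψ, z]
  have hov := eventually_chart_overlap hy
  have hzt := hov.self_of_nhds
  -- Near `y`, the two chart expressions of `α` differ by pullback along the transition map `ψ`, and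
  -- pullback commutes with the exterior derivative.
  have e : chartForm α y =ᶠ[𝓝 z]
      fun z => (chartForm α m (ψ z)).compContinuousLinearMap (fderiv ℝ ψ z) := by
    filter_upwards [hov] with w hw
    have h₁ : chartCoeff α y w = chartCoeff α m (ψ w) ∘L fderiv ℝ ψ w := by
      rw [← dchart_comp_dchartSymm_eq_fderiv hw.1 hw.2, ← ContinuousLinearMap.comp_assoc]
      exact congrArg (fun f => f ∘L dchartSymm y w) (chartCoeff_comp_dchart α hw.2).symm
    rw [chartForm_eq, chartForm_eq]
    dsimp only
    rw [h₁]
    ext v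
    rfl
  have hd : DifferentiableAt ℝ (chartForm α m) (ψ z) := by
    rw [hψz, chartForm_eq]
    exact (hasFDerivAt_ofSubsingleton hα).differentiableAt
  have hf : fderiv ℝ ψ z ∘L dchart y y = dchart m y := by
    have h₁ := dchart_comp_dchartSymm_eq_fderiv hzt.1 hzt.2
    have h₂ := dchartSymm_comp_dchart hzt.1
    -- The base point `(extChartAt (𝓡 6) y).symm z` equals `y` only propositionally, and it occurs
    -- in the types of the differentials. Generalizing it to `x` permits the substitution.
    have key : ∀ x, x = y → (extChartAt (𝓡 6) y).symm z = x →
        fderiv ℝ ψ z ∘L dchart y x = dchart m x := by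
      rintro x - rfl
      rw [← h₁, ContinuousLinearMap.comp_assoc, h₂, ContinuousLinearMap.comp_id]
    exact key y rfl (extChartAt_to_inv y)
  have hf' : ∀ w, fderiv ℝ ψ z (dchart y y w) = dchart m y w := fun w =>
    congrArg (fun f => f w) hf
  have hs : minSmoothness ℝ 2 ≤ (∞ : WithTop ℕ∞) := by
    have h₂ : (2 : WithTop ℕ∞) ≤ ∞ := WithTop.coe_le_coe.2 (le_top : (2 : ℕ∞) ≤ ⊤)
    simpa using h₂
  have h := (Filter.EventuallyEq.extDeriv_eq e).trans
    (extDeriv_pullback hd (contDiffAt_chart_transition hzt.1 hzt.2) hs)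
  change extDeriv (chartForm α y) z (fun i => dchart y y (v i)) = _
  rw [h]
  change extDeriv (chartForm α m) (ψ z) (fun i => fderiv ℝ ψ z (dchart y y (v i))) = _
  rw [hψz, chartForm_eq, extDeriv_ofSubsingleton hα, hf', hf']

/-- The chart at `m` serves all `y` in its domain, so the components of an exterior derivative
become a function on an open subset of `E6` that can be differentiated again. -/
theorem dFrame_apply (s : FrameField M) (a : M → T →L[ℝ] F) {m y : M}
    (hy : y ∈ (extChartAt (𝓡 6) m).source)
    (ha : DifferentiableAt ℝ (chartCoeff (formOf s a) m) (extChartAt (𝓡 6) m y))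
    (v : Fin 2 → T) :
    dFrame s a y v
      = fderiv ℝ (chartCoeff (formOf s a) m) (extChartAt (𝓡 6) m y) (frameMap s m y (v 0))
          (frameMap s m y (v 1))
        - fderiv ℝ (chartCoeff (formOf s a) m) (extChartAt (𝓡 6) m y) (frameMap s m y (v 1))
          (frameMap s m y (v 0)) :=
  extD_apply (formOf s a) hy ha fun i => s y (v i)

/-- In the tangent bundle trivialization at `m`, a vector is represented by its image under the
differential of the chart at `m`. Smoothness of `s` as a section is therefore smoothness of
`frameMap`, tested on each vector of `T`. -/
theorem contDiffAt_frameMap {U : Set M} {s : FrameField M} (hs : IsSmoothFrameOn U s) {m : M}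
    {z : E6} (hz : z ∈ (extChartAt (𝓡 6) m).target) (hU : (extChartAt (𝓡 6) m).symm z ∈ U) :
    ContDiffAt ℝ ∞ (fun z => frameMap s m ((extChartAt (𝓡 6) m).symm z)) z := by
  set W := (extChartAt (𝓡 6) m).target ∩ (extChartAt (𝓡 6) m).symm ⁻¹' U with hW
  have hWo : IsOpen W :=
    (continuousOn_extChartAt_symm m).isOpen_inter_preimage (isOpen_extChartAt_target m) hs.1
  suffices h : ContDiffOn ℝ ∞ (fun z => frameMap s m ((extChartAt (𝓡 6) m).symm z)) W from
    h.contDiffAt (hWo.mem_nhds ⟨hz, hU⟩)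
  refine contDiffOn_clm_apply.2 fun t w hw => ContDiffAt.contDiffWithinAt ?_
  have hx : (extChartAt (𝓡 6) m).symm w ∈ (chartAt E6 m).source := by
    rw [← extChartAt_source (𝓡 6)]
    exact (extChartAt (𝓡 6) m).map_target hw.1
  have h₁ := (hs.2 t).contMDiffAt (hs.1.mem_nhds hw.2)
  have h₂ := (Bundle.Trivialization.contMDiffAt_section_iff
    (trivializationAt E6 (TangentSpace (𝓡 6)) m) (by simpa using hx)).1 h₁
  have h₃ := h₂.comp w (((contMDiffOn_extChartAt_symm (I := 𝓡 6) (n := ∞) m) w hw.1).contMDiffAt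
    ((isOpen_extChartAt_target m).mem_nhds hw.1))
  refine h₃.contDiffAt.congr_of_eventuallyEq ?_
  filter_upwards [(isOpen_extChartAt_target (I := 𝓡 6) m).mem_nhds hw.1] with w' hw'
  have hx' : (extChartAt (𝓡 6) m).symm w' ∈ (chartAt E6 m).source := by
    rw [← extChartAt_source (𝓡 6)]
    exact (extChartAt (𝓡 6) m).map_target hw'
  have e := TangentBundle.continuousLinearMapAt_trivializationAt (I := 𝓡 6) hx'
  change dchart m _ (s ((extChartAt (𝓡 6) m).symm w') t) = _
  rw [dchart, ← e, Bundle.Trivialization.continuousLinearMapAt_apply,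
    Bundle.Trivialization.coe_linearMapAt_of_mem _ (by simpa using hx')]
  rfl

/-- In the chart the coframe is the pointwise inverse of the frame, and inversion is smooth at
invertible operators. -/
theorem contDiffAt_coframe {U : Set M} {s : FrameField M} (hs : IsSmoothFrameOn U s) {m : M}
    {z : E6} (hz : z ∈ (extChartAt (𝓡 6) m).target) (hU : (extChartAt (𝓡 6) m).symm z ∈ U) :
    ContDiffAt ℝ ∞ (coframe s m) z := by
  have hinv : ∀ w ∈ (extChartAt (𝓡 6) m).target,
      coframe s m w = (frameMap s m ((extChartAt (𝓡 6) m).symm w)).inverse := fun w hw =>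
    (ContinuousLinearMap.inverse_eq (frameMap_comp_coframe s hw) (coframe_comp_frameMap s hw)).symm
  have h := ((ContinuousLinearMap.IsInvertible.of_inverse (frameMap_comp_coframe s hz)
    (coframe_comp_frameMap s hz)).contDiffAt_map_inverse (𝕜 := ℝ) (n := ∞)).comp z
    (contDiffAt_frameMap hs hz hU)
  refine h.congr_of_eventuallyEq ?_
  filter_upwards [(isOpen_extChartAt_target (I := 𝓡 6) m).mem_nhds hz] with w hw using hinv w hw

end Charts

/-! ### The Levi-Civita form in a chart -/

/-- The linear map `B ↦ ∂⁻¹(alt B)`. -/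
def deltaInvAlt : (T →L[ℝ] T →L[ℝ] T) →ₗ[ℝ] (T →ₗ[ℝ] so6) where
  toFun B := (deltaEquiv.symm (alt2 B)).toLinearMap
  map_add' B B' := by
    have h : alt2 (B + B') = alt2 B + alt2 B' := ContinuousAlternatingMap.ext fun v => by
      change B (v 0) (v 1) + B' (v 0) (v 1) - (B (v 1) (v 0) + B' (v 1) (v 0))
        = B (v 0) (v 1) - B (v 1) (v 0) + (B' (v 0) (v 1) - B' (v 1) (v 0))
      abel
    rw [h, map_add]; rfl
  map_smul' c B := by
    have h : alt2 (c • B) = c • alt2 B := ContinuousAlternatingMap.ext fun v => by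
      change c • B (v 0) (v 1) - c • B (v 1) (v 0) = c • (B (v 0) (v 1) - B (v 1) (v 0))
      rw [smul_sub]
    rw [h, map_smul]; rfl

section Curvature

variable {M : Type*} [TopologicalSpace M] [ChartedSpace E6 M] 
  {U : Set M} {s : FrameField M} {m : M} {z : E6}

theorem eventually_mem_chart_preimage (hU : IsOpen U) (hz : z ∈ (extChartAt (𝓡 6) m).target)
    (hzU : (extChartAt (𝓡 6) m).symm z ∈ U) :
    ∀ᶠ w in 𝓝 z, w ∈ (extChartAt (𝓡 6) m).target ∧ (extChartAt (𝓡 6) m).symm w ∈ U :=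
  ((continuousOn_extChartAt_symm m).isOpen_inter_preimage (isOpen_extChartAt_target m)
    hU).mem_nhds ⟨hz, hzU⟩

variable [IsManifold (𝓡 6) ∞ M]

/-- The components in the frame `s` of the derivative of the coframe in the chart at `m`. -/
def coframeDeriv (s : FrameField M) (m : M) (z : E6) : T →L[ℝ] T →L[ℝ] T :=
  ((ContinuousLinearMap.compL ℝ T E6 T).flip (frameMap s m ((extChartAt (𝓡 6) m).symm z))) ∘L
    fderiv ℝ (coframe s m) z ∘L frameMap s m ((extChartAt (𝓡 6) m).symm z)

/-- Being valid throughout the chart, this exhibits `dCoframe` as the alternation of a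
differentiable function of `z`. -/
theorem dCoframe_eq (hs : IsSmoothFrameOn U s) (hz : z ∈ (extChartAt (𝓡 6) m).target)
    (hU : (extChartAt (𝓡 6) m).symm z ∈ U) :
    dCoframe s ((extChartAt (𝓡 6) m).symm z) = alt2 (coframeDeriv s m z) := by
  refine ContinuousAlternatingMap.ext fun v => ?_
  have hd := (contDiffAt_coframe hs hz hU).differentiableAt (by simp)
  have h := dFrame_apply s (fun _ => ContinuousLinearMap.id ℝ T)
    (m := m) ((extChartAt (𝓡 6) m).map_target hz)
    (by rw [(extChartAt (𝓡 6) m).right_inv hz]; exact hd) v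
  rw [(extChartAt (𝓡 6) m).right_inv hz, chartCoeff_coframe] at h
  exact h

theorem contDiffAt_coframeDeriv (hs : IsSmoothFrameOn U s) (hz : z ∈ (extChartAt (𝓡 6) m).target)
    (hU : (extChartAt (𝓡 6) m).symm z ∈ U) : ContDiffAt ℝ 1 (coframeDeriv s m) z := by
  have h₂ : (1 + 1 : WithTop ℕ∞) ≤ ∞ := WithTop.coe_le_coe.2 (le_top : (1 + 1 : ℕ∞) ≤ ⊤)
  have hf := (contDiffAt_frameMap hs hz hU).of_le (m := 1)
    (WithTop.coe_le_coe.2 (le_top : (1 : ℕ∞) ≤ ⊤))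
  have hd := (contDiffAt_coframe hs hz hU).fderiv_right h₂
  exact ((ContinuousLinearMap.contDiff
    (ContinuousLinearMap.compL ℝ T E6 T).flip).contDiffAt.comp z hf).clm_comp (hd.clm_comp hf)

/-! ### Forms depending linearly on the differential of the coframe -/

section ConnectionForm

variable {F : Type*} [NormedAddCommGroup F] [NormedSpace ℝ F] {w : M → T →L[ℝ] F}

/-- The hypothesis `hw` abstracts the Levi-Civita form `-∂⁻¹(dθ)`: `w` is a fixed linear function of
any bilinear `B` whose alternation is `dθ`. Taking `B = coframeDeriv s m y` makes the dependence on
`y` differentiable, since `L` is automatically continuous in finite dimensions. -/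
theorem differentiableAt_connection {L : (T →L[ℝ] T →L[ℝ] T) →ₗ[ℝ] (T →ₗ[ℝ] F)}
    (hs : IsSmoothFrameOn U s) (hw : ∀ x ∈ U, ∀ B, dCoframe s x = alt2 B → ∀ t, w x t = -L B t)
    (hz : z ∈ (extChartAt (𝓡 6) m).target) (hU : (extChartAt (𝓡 6) m).symm z ∈ U) :
    DifferentiableAt ℝ (chartCoeff (formOf s w) m) z := by
  let L' : (T →L[ℝ] T →L[ℝ] T) →L[ℝ] (T →L[ℝ] F) := LinearMap.toContinuousLinearMap
    ((LinearMap.toContinuousLinearMap (𝕜 := ℝ) (E := T) (F' := F)).toLinearMap ∘ₗ L)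
  have h : DifferentiableAt ℝ (fun y => (-L' (coframeDeriv s m y)) ∘L coframe s m y) z :=
    (L'.differentiableAt.comp z
      ((contDiffAt_coframeDeriv hs hz hU).differentiableAt one_ne_zero)).neg.clm_comp
      ((contDiffAt_coframe hs hz hU).differentiableAt (by simp))
  refine h.congr_of_eventuallyEq ?_
  filter_upwards [eventually_mem_chart_preimage hs.1 hz hU] with y hy
  have e : w ((extChartAt (𝓡 6) m).symm y) = -L' (coframeDeriv s m y) :=
    ContinuousLinearMap.ext (hw _ hy.2 _ (dCoframe_eq hs hy.1 hy.2))
  rw [chartCoeff_formOf, e]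

/-- The structure equation `dθ + ω ∧ θ = 0` in a chart. -/
theorem structure_equation (i : F →L[ℝ] T →L[ℝ] T) (hs : IsSmoothFrameOn U s)
    (hi : ∀ x ∈ U, ∀ a b, i (w x a) b - i (w x b) a = -dCoframe s x ![a, b])
    (hz : z ∈ (extChartAt (𝓡 6) m).target)
    (hU : (extChartAt (𝓡 6) m).symm z ∈ U) (u v : E6) :
    fderiv ℝ (coframe s m) z u v - fderiv ℝ (coframe s m) z v u
      = i (chartCoeff (formOf s w) m z v) (coframe s m z u)
        - i (chartCoeff (formOf s w) m z u) (coframe s m z v) := by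
  have hfc : ∀ u, frameMap s m ((extChartAt (𝓡 6) m).symm z) (coframe s m z u) = u := fun u =>
    congrArg (fun f => f u) (frameMap_comp_coframe s hz)
  have h := hi _ hU (coframe s m z u) (coframe s m z v)
  rw [dCoframe_eq hs hz hU] at h
  change _ = -(fderiv ℝ (coframe s m) z (frameMap s m _ (coframe s m z u))
        (frameMap s m _ (coframe s m z v))
      - fderiv ℝ (coframe s m) z (frameMap s m _ (coframe s m z v))
        (frameMap s m _ (coframe s m z u))) at h
  rw [hfc, hfc] at h
  rw [← neg_inj, ← h, neg_sub]
  rfl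

/-- The first Bianchi identity for the curvature `dω + ½ [ω ∧ ω]` of a torsion-free connection
form `ω` along a frame `s`. -/
theorem bianchi_of_torsionFree {L : (T →L[ℝ] T →L[ℝ] T) →ₗ[ℝ] (T →ₗ[ℝ] F)}
    (i : F →L[ℝ] T →L[ℝ] T) (hs : IsSmoothFrameOn U s)
    (hw : ∀ x ∈ U, ∀ B, dCoframe s x = alt2 B → ∀ t, w x t = -L B t)
    (hi : ∀ x ∈ U, ∀ a b, i (w x a) b - i (w x b) a = -dCoframe s x ![a, b])
    {Ω : T → T → T →L[ℝ] T} {x : M} (hx : x ∈ U)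
    (hΩ : ∀ a b, Ω a b = i (dFrame s w x ![a, b])
      + (i (w x a) * i (w x b) - i (w x b) * i (w x a))) (a b c : T) :
    Ω a b c + Ω b c a + Ω c a b = 0 := by
  -- Writing `x` as the image of a chart point avoids transporting along `extChartAt_to_inv` later.
  obtain ⟨m, z, hz, rfl⟩ : ∃ m : M, ∃ z ∈ (extChartAt (𝓡 6) m).target,
      (extChartAt (𝓡 6) m).symm z = x :=
    ⟨x, _, mem_extChartAt_target x, extChartAt_to_inv x⟩
  have hd := differentiableAt_connection hs hw hz hx
  have hcf : ∀ t, coframe s m z (frameMap s m ((extChartAt (𝓡 6) m).symm z) t) = t := fun t =>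
    congrArg (fun f => f t) (coframe_comp_frameMap s hz)
  have hfc : ∀ u, frameMap s m ((extChartAt (𝓡 6) m).symm z) (coframe s m z u) = u := fun u =>
    congrArg (fun f => f u) (frameMap_comp_coframe s hz)
  have key := bianchi_of_structure_equation i (contDiffAt_coframe hs hz hx) hd
    ((eventually_mem_chart_preimage hs.1 hz hx).mono fun y hy u v =>
      structure_equation i hs hi hy.1 hy.2 u v)
    -- The curvature is moved to chart vectors by the coframe; evaluating at `frameMap` of `a`, `b`,
    -- `c` moves it back.
    (Ω := fun u v => Ω (coframe s m z u) (coframe s m z v))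
    (fun u v => by
      have e := dFrame_apply s w ((extChartAt (𝓡 6) m).map_target hz)
        (by rw [(extChartAt (𝓡 6) m).right_inv hz]; exact hd) ![coframe s m z u, coframe s m z v]
      rw [(extChartAt (𝓡 6) m).right_inv hz] at e
      simp only [Matrix.cons_val_zero, Matrix.cons_val_one, hfc] at e
      rw [hΩ, e, map_sub]
      rfl)
    (frameMap s m ((extChartAt (𝓡 6) m).symm z) a) (frameMap s m ((extChartAt (𝓡 6) m).symm z) b)
    (frameMap s m ((extChartAt (𝓡 6) m).symm z) c)
  simpa only [hcf] using key

/-- Fibrewise linear maps commute with the exterior derivative. -/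
theorem dFrame_comp {G : Type*} [NormedAddCommGroup G] [NormedSpace ℝ G] (j : F →L[ℝ] G)
    {L : (T →L[ℝ] T →L[ℝ] T) →ₗ[ℝ] (T →ₗ[ℝ] F)}
    (hs : IsSmoothFrameOn U s) (hw : ∀ x ∈ U, ∀ B, dCoframe s x = alt2 B → ∀ t, w x t = -L B t)
    {x : M} (hx : x ∈ U) (v : Fin 2 → T) :
    dFrame s (fun y => j ∘L w y) x v = j (dFrame s w x v) := by
  have hd : DifferentiableAt ℝ (chartCoeff (formOf s w) x) (extChartAt (𝓡 6) x x) :=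
    differentiableAt_connection hs hw (mem_extChartAt_target x) (by rwa [extChartAt_to_inv])
  have hD : HasFDerivAt (chartCoeff (formOf s fun y => j ∘L w y) x)
      (ContinuousLinearMap.compL ℝ E6 F G j ∘L
        fderiv ℝ (chartCoeff (formOf s w) x) (extChartAt (𝓡 6) x x)) (extChartAt (𝓡 6) x x) :=
    (ContinuousLinearMap.compL ℝ E6 F G j).hasFDerivAt.comp _ hd.hasFDerivAt
  rw [dFrame_apply s w (mem_extChartAt_source x) hd,
    dFrame_apply s _ (mem_extChartAt_source x) hD.differentiableAt, hD.fderiv, map_sub]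
  rfl

/-- The exterior derivative of a form vanishing on an open set vanishes there. -/
theorem dFrame_eq_zero (hU : IsOpen U) (hw : ∀ x ∈ U, w x = 0) {x : M} (hx : x ∈ U) :
    dFrame s w x = 0 := by
  have h : chartCoeff (formOf s w) x =ᶠ[𝓝 (extChartAt (𝓡 6) x x)] fun _ => 0 := by
    filter_upwards [eventually_mem_chart_preimage hU (mem_extChartAt_target x)
      (by rwa [extChartAt_to_inv])] with y hy
    rw [chartCoeff_formOf, hw _ hy.2, ContinuousLinearMap.zero_comp]
  refine ContinuousAlternatingMap.ext fun v => ?_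
  rw [dFrame_apply s w (mem_extChartAt_source x)
    ((differentiableAt_const _).congr_of_eventuallyEq h), h.fderiv_eq]
  simp

end ConnectionForm

end Curvature

/-! ### The curvatures -/

/-- `[a ∧ a](x, y)` is twice the commutator `[a x, a y]`, which the factor `½` in the curvature
compensates. -/
theorem half_smul_bracket (A B : T →L[ℝ] T) :
    (1 / 2 : ℝ) • (A * B - B * A - (B * A - A * B)) = A * B - B * A := by
  rw [← neg_sub (A * B) (B * A), sub_neg_eq_add, ← two_smul ℝ, smul_smul]
  norm_num

/-- Continuous linear maps between normed spaces, for the topologies induced by the norms. The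
spaces `so6`, `so3` and `so3perp` carry the same topology as a subspace, but unification is slow to
see this, so that the maps between them are restated with this type. -/
abbrev NormedHom (E F : Type*) [NormedAddCommGroup E] [NormedSpace ℝ E] [NormedAddCommGroup F]
    [NormedSpace ℝ F] : Type _ := E →L[ℝ] F

/-- Linear maps into `T* ⊗ F` for a normed space `F`. -/
abbrev NormedFormHom (E F : Type*) [AddCommGroup E] [Module ℝ E] [NormedAddCommGroup F]
    [NormedSpace ℝ F] : Type _ := E →ₗ[ℝ] (T →ₗ[ℝ] F)

/-- `deltaInvAlt` over the normed space `so6`. -/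
def deltaInvHom : NormedFormHom (T →L[ℝ] T →L[ℝ] T) so6 := deltaInvAlt

/-- `projSo3` between normed spaces. -/
def projSo3Hom : NormedHom so6 so3 := projSo3

/-- `-projPerp` between normed spaces. -/
def negProjPerpHom : NormedHom so6 so3perp := -projPerp

/-- The inclusion of `so6` as a map of normed spaces. -/
def so6Hom : NormedHom so6 (T →L[ℝ] T) := so6.subtypeL

section Structure

variable {M : Type*} [TopologicalSpace M] [ChartedSpace E6 M]

theorem leviCivitaCurvature_apply (s : FrameField M) (x : M) (v : Fin 2 → T) :
    (leviCivitaCurvature s x v : T →L[ℝ] T)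
      = (dFrame (F := so6) s (leviCivitaForm s) x v : T →L[ℝ] T)
        + ((leviCivitaForm s x (v 0) : T →L[ℝ] T) * (leviCivitaForm s x (v 1) : T →L[ℝ] T)
          - (leviCivitaForm s x (v 1) : T →L[ℝ] T) * (leviCivitaForm s x (v 0) : T →L[ℝ] T)) :=
  congrArg (fun A : T →L[ℝ] T => (dFrame (F := so6) s (leviCivitaForm s) x v : T →L[ℝ] T) + A)
    (half_smul_bracket (leviCivitaForm s x (v 0)) (leviCivitaForm s x (v 1)))

theorem canonicalCurvature_apply (s : FrameField M) (x : M) (v : Fin 2 → T) :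
    (canonicalCurvature s x v : T →L[ℝ] T)
      = (dFrame (F := so3) s (canonicalForm s) x v : T →L[ℝ] T)
        + ((canonicalForm s x (v 0) : T →L[ℝ] T) * (canonicalForm s x (v 1) : T →L[ℝ] T)
          - (canonicalForm s x (v 1) : T →L[ℝ] T) * (canonicalForm s x (v 0) : T →L[ℝ] T)) :=
  congrArg (fun A : T →L[ℝ] T => (dFrame (F := so3) s (canonicalForm s) x v : T →L[ℝ] T) + A)
    (half_smul_bracket (canonicalForm s x (v 0)) (canonicalForm s x (v 1)))

theorem sqBracket_tsq_apply (a : TorsionSpace) (v : Fin 2 → T) :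
    (sqBracket (tsq a) v : T →L[ℝ] T)
      = (a (v 0) : T →L[ℝ] T) * (a (v 1) : T →L[ℝ] T)
        - (a (v 1) : T →L[ℝ] T) * (a (v 0) : T →L[ℝ] T) :=
  half_smul_bracket (a (v 0)) (a (v 1))

/-- This presents `τ` as a constant linear image of the Levi-Civita form, so that `dFrame_comp`
computes `dτ`. -/
theorem intrinsicTorsion_eq_comp (s : FrameField M) (x : M) :
    intrinsicTorsion s x = (-projPerp) ∘L leviCivitaForm s x := by
  refine ContinuousLinearMap.ext fun t => ?_
  change projPerp (deltaEquiv.symm (dCoframe s x) t)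
    = -projPerp (-(deltaEquiv.symm (dCoframe s x) t))
  exact ((congrArg Neg.neg (map_neg projPerp _)).trans (neg_neg _)).symm

/-- The Levi-Civita form is the canonical form minus the intrinsic torsion. -/
theorem leviCivitaForm_apply (s : FrameField M) (x : M) (t : T) :
    (leviCivitaForm s x t : T →L[ℝ] T)
      = (canonicalForm s x t : T →L[ℝ] T) - (intrinsicTorsion s x t : T →L[ℝ] T) := by
  rw [intrinsicTorsion_eq_comp]
  change _ = (projSo3 (leviCivitaForm s x t) : T →L[ℝ] T)
    - -(projPerp (leviCivitaForm s x t) : T →L[ℝ] T)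
  rw [sub_neg_eq_add, projSo3_add_projPerp]

/-- `leviCivitaForm` over the normed space `so6`. -/
def leviCivitaHom (s : FrameField M) : M → NormedHom T so6 := leviCivitaForm s

/-- `canonicalForm` over the normed space `so3`. -/
def canonicalHom (s : FrameField M) : M → NormedHom T so3 := canonicalForm s

/-- `intrinsicTorsion` over the normed space `so3perp`. -/
def intrinsicTorsionHom (s : FrameField M) : M → NormedHom T so3perp := intrinsicTorsion s

theorem canonicalHom_eq (s : FrameField M) :
    canonicalHom s = fun x => projSo3Hom ∘L leviCivitaHom s x := rfl

theorem intrinsicTorsionHom_eq (s : FrameField M) :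
    intrinsicTorsionHom s = fun x => negProjPerpHom ∘L leviCivitaHom s x :=
  funext fun x => ContinuousLinearMap.ext fun t =>
    congrArg (fun f : TorsionSpace => f t) (intrinsicTorsion_eq_comp s x)

theorem leviCivitaHom_apply (s : FrameField M) (x : M) (B : T →L[ℝ] T →L[ℝ] T)
    (h : dCoframe s x = alt2 B) (t : T) : leviCivitaHom s x t = -deltaInvHom B t := by
  change (-deltaEquiv.symm (dCoframe s x)) t = _
  rw [h]; rfl

variable [IsManifold (𝓡 6) ∞ M] {U : Set M} {s : FrameField M} {x : M}

theorem dFrame_canonicalHom (hs : IsSmoothFrameOn U s) (hx : x ∈ U) (v : Fin 2 → T) :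
    dFrame (F := so3) s (canonicalHom s) x v
      = projSo3Hom (dFrame (F := so6) s (leviCivitaHom s) x v) := by
  rw [canonicalHom_eq]
  exact dFrame_comp (F := so6) (G := so3) projSo3Hom hs
    (fun x _ B h => leviCivitaHom_apply s x B h) hx v

theorem dFrame_canonicalForm (hs : IsSmoothFrameOn U s) (hx : x ∈ U) (v : Fin 2 → T) :
    dFrame (F := so3) s (canonicalForm s) x v
      = projSo3 (dFrame (F := so6) s (leviCivitaForm s) x v) :=
  dFrame_canonicalHom hs hx v

theorem dFrame_intrinsicTorsionHom (hs : IsSmoothFrameOn U s) (hx : x ∈ U) (v : Fin 2 → T) :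
    dFrame (F := so3perp) s (intrinsicTorsionHom s) x v
      = negProjPerpHom (dFrame (F := so6) s (leviCivitaHom s) x v) := by
  rw [intrinsicTorsionHom_eq]
  exact dFrame_comp (F := so6) (G := so3perp) negProjPerpHom hs
    (fun x _ B h => leviCivitaHom_apply s x B h) hx v

theorem dFrame_intrinsicTorsion (hs : IsSmoothFrameOn U s) (hx : x ∈ U) (v : Fin 2 → T) :
    (dFrame (F := so3perp) s (intrinsicTorsion s) x v : T →L[ℝ] T)
      = -(projPerp (dFrame (F := so6) s (leviCivitaForm s) x v) : T →L[ℝ] T) :=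
  congrArg Subtype.val (dFrame_intrinsicTorsionHom hs hx v)

/-- With the Levi-Civita form equal to `ω - τ`, its curvature is `dω - dτ + ½[ω ∧ ω] - [ω ∧ τ] + ½[τ
∧ τ]`, that is, `Ω - Dτ + ½[τ ∧ τ]`. -/
theorem inclSo3_canonicalCurvature (hs : IsSmoothFrameOn U s) (hx : x ∈ U) :
    inclForm inclSo3 (canonicalCurvature s x) = leviCivitaCurvature s x
      + curvDiff (tsq (intrinsicTorsion s x), covTorsion s x) := by
  refine ContinuousAlternatingMap.ext fun v => Subtype.ext ?_
  change (canonicalCurvature s x v : T →L[ℝ] T) = (leviCivitaCurvature s x v : T →L[ℝ] T)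
    + (((dFrame (F := so3perp) s (intrinsicTorsion s) x v : T →L[ℝ] T)
      + ((canonicalForm s x (v 0) : T →L[ℝ] T) * (intrinsicTorsion s x (v 1) : T →L[ℝ] T)
        - (intrinsicTorsion s x (v 1) : T →L[ℝ] T) * (canonicalForm s x (v 0) : T →L[ℝ] T)
        - ((canonicalForm s x (v 1) : T →L[ℝ] T) * (intrinsicTorsion s x (v 0) : T →L[ℝ] T)
        - (intrinsicTorsion s x (v 0) : T →L[ℝ] T) * (canonicalForm s x (v 1) : T →L[ℝ] T))))
      - (sqBracket (tsq (intrinsicTorsion s x)) v : T →L[ℝ] T))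
  rw [canonicalCurvature_apply, leviCivitaCurvature_apply, sqBracket_tsq_apply,
    dFrame_canonicalForm hs hx, dFrame_intrinsicTorsion hs hx, leviCivitaForm_apply,
    -- The exterior derivative of the Levi-Civita form splits into its two projections, `dω` and
    -- `-dτ`; only commutator algebra is then left.
    leviCivitaForm_apply, ← projSo3_add_projPerp (dFrame (F := so6) s (leviCivitaForm s) x v)]
  noncomm_ring

theorem bianchi_leviCivitaCurvature (hs : IsSmoothFrameOn U s) (hx : x ∈ U) (a b c : T) :
    (leviCivitaCurvature s x ![a, b] : T →L[ℝ] T) c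
      + (leviCivitaCurvature s x ![b, c] : T →L[ℝ] T) a
      + (leviCivitaCurvature s x ![c, a] : T →L[ℝ] T) b = 0 :=
  bianchi_of_torsionFree (F := so6) (w := leviCivitaHom s) (L := deltaInvHom) so6Hom hs
    (fun x _ B h => leviCivitaHom_apply s x B h)
    (fun y _ a b => congrArg (fun f => f ![a, b]) (delta_neg_symm (dCoframe s y)))
    (Ω := fun a b => leviCivitaCurvature s x ![a, b]) hx
    (fun a b => leviCivitaCurvature_apply s x ![a, b]) a b c

theorem bianchiForm_leviCivitaCurvature (hs : IsSmoothFrameOn U s) (hx : x ∈ U)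
    (a b c d : T) : bianchiForm (leviCivitaCurvature s x) a b c d = 0 := by
  rw [bianchiForm, quad, quad, quad, ← inner_add_left, ← inner_add_left,
    bianchi_leviCivitaCurvature hs hx, inner_zero_left]

/-- The torsion and its covariant derivative determine both curvatures. -/
theorem curvatureMap_torsion (hs : IsSmoothFrameOn U s) (hx : x ∈ U) :
    curvatureMap6 (tsq (intrinsicTorsion s x), covTorsion s x) = leviCivitaCurvature s x ∧
    curvatureMap3 (tsq (intrinsicTorsion s x), covTorsion s x) = canonicalCurvature s x :=
  curvatureMap_eq (inclSo3_canonicalCurvature hs hx) (bianchiForm_leviCivitaCurvature hs hx)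

/-! ### Flatness for vanishing torsion -/

theorem dFrame_intrinsicTorsion_eq_zero (hU : IsOpen U) (h : ∀ y ∈ U, intrinsicTorsion s y = 0)
    (hx : x ∈ U) : dFrame (F := so3perp) s (intrinsicTorsionHom s) x = 0 :=
  dFrame_eq_zero (F := so3perp) (w := intrinsicTorsionHom s) hU
    (fun y hy => ContinuousLinearMap.ext fun t =>
      congrArg (fun f : TorsionSpace => f t) (h y hy)) hx

/-- The term `dτ` involves a derivative, so `τ` must vanish on the whole open set and not just at
`x`. -/
theorem covTorsion_eq_zero (hU : IsOpen U) (h : ∀ y ∈ U, intrinsicTorsion s y = 0) (hx : x ∈ U) :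
    covTorsion s x = 0 := by
  refine ContinuousAlternatingMap.ext fun v => Subtype.ext ?_
  have e : (dFrame (F := so3perp) s (intrinsicTorsion s) x v : T →L[ℝ] T) = 0 :=
    congrArg (fun f => (f v : T →L[ℝ] T)) (dFrame_intrinsicTorsion_eq_zero hU h hx)
  change (dFrame (F := so3perp) s (intrinsicTorsion s) x v : T →L[ℝ] T)
      + ((canonicalForm s x (v 0) : T →L[ℝ] T) * (intrinsicTorsion s x (v 1) : T →L[ℝ] T)
        - (intrinsicTorsion s x (v 1) : T →L[ℝ] T) * (canonicalForm s x (v 0) : T →L[ℝ] T)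
        - ((canonicalForm s x (v 1) : T →L[ℝ] T) * (intrinsicTorsion s x (v 0) : T →L[ℝ] T)
        - (intrinsicTorsion s x (v 0) : T →L[ℝ] T) * (canonicalForm s x (v 1) : T →L[ℝ] T))) = 0
  rw [e, h x hx]
  simp

theorem tsq_covTorsion_eq_zero (hs : IsSmoothFrameOn U s)
    (h : ∀ y ∈ U, intrinsicTorsion s y = 0) (hx : x ∈ U) :
    (tsq (intrinsicTorsion s x), covTorsion s x) = (tsq (0 : TorsionSpace), 0) :=
  congrArg₂ (fun a b => (tsq a, b)) (h x hx) (covTorsion_eq_zero hs.1 h hx)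

theorem leviCivitaCurvature_eq_zero (hs : IsSmoothFrameOn U s)
    (h : ∀ y ∈ U, intrinsicTorsion s y = 0) (hx : x ∈ U) : leviCivitaCurvature s x = 0 :=
  ((curvatureMap_torsion hs hx).1.symm.trans
    (congrArg curvatureMap6 (tsq_covTorsion_eq_zero hs h hx))).trans curvatureMap6_zero

theorem canonicalCurvature_eq_zero (hs : IsSmoothFrameOn U s)
    (h : ∀ y ∈ U, intrinsicTorsion s y = 0) (hx : x ∈ U) : canonicalCurvature s x = 0 :=
  ((curvatureMap_torsion hs hx).2.symm.trans
    (congrArg curvatureMap3 (tsq_covTorsion_eq_zero hs h hx))).trans curvatureMap3_zero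

theorem SO3Structure.TorsionFree.isFlat {P : SO3Structure M} (hP : P.TorsionFree) :
    P.IsFlat := fun U s hs _ hx =>
  ⟨leviCivitaCurvature_eq_zero hs.1 (hP U s hs) hx,
    canonicalCurvature_eq_zero hs.1 (hP U s hs) hx⟩

end Structure

end SO3Geom

end

theorem mainTheorem8 :
    (∃ (R₆ : SO3Geom.sourceRep.IntertwiningMap SO3Geom.curvRep6)
       (R₃ : SO3Geom.sourceRep.IntertwiningMap SO3Geom.curvRep3),
      ∀ (M : Type*) [TopologicalSpace M] [ChartedSpace SO3Geom.E6 M] [IsManifold (𝓡 6) ∞ M]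
        (P : SO3Geom.SO3Structure M) (U : Set M) (s : SO3Geom.FrameField M),
        P.IsLocalSection U s → ∀ x ∈ U,
          R₆ (SO3Geom.tsq (SO3Geom.intrinsicTorsion s x), SO3Geom.covTorsion s x)
              = SO3Geom.leviCivitaCurvature s x ∧
          R₃ (SO3Geom.tsq (SO3Geom.intrinsicTorsion s x), SO3Geom.covTorsion s x)
              = SO3Geom.canonicalCurvature s x) ∧
    (∀ (M : Type*) [TopologicalSpace M] [ChartedSpace SO3Geom.E6 M] [IsManifold (𝓡 6) ∞ M]
        (P : SO3Geom.SO3Structure M), P.TorsionFree → P.IsFlat) :=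
  ⟨⟨SO3Geom.curvatureMap6, SO3Geom.curvatureMap3, fun _ _ _ _ _ _ _ hs _ hx =>
    SO3Geom.curvatureMap_torsion hs.1 hx⟩, fun _ _ _ _ _ hP => hP.isFlat⟩
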